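/- Let $h,g:[0,1]\to\mathbb R$ be continuous with $\int_0^1 g(q)^2\,dq=1$. For $r\in[0,1]$ put $$I_1(r)=\int_0^r g(q)^2dq,\quad I_2(r)=\int_0^r h(q)g(q)\,dq,\quad I_3(r)=\int_0^r h(q)\,dq,\quad I_4(r)=\int_0^r h(q)^2dq,\quad I_5(r)=\int_0^r g(q)\,dq,$$ and, writing $I_j=I_j(r)$, $h=h(r)$, $g=g(r)$, define $$\begin{aligned} \varphi_1(r)={}&g-h-3I_2g+I_5hg+I_3g^2+2I_2h-2I_2I_3g^2+I_1I_2^2h+I_4I_5g^2-I_2^3g-I_2I_4g+3I_2^2g+I_2I_5h^2\\ &\quad -2I_2I_5hg-2I_1I_2h+I_2^2I_5hg+I_1^2I_3h^2-I_4h+2I_1I_4h-I_1I_4g+I_1I_2I_4g+I_1I_4I_5hg\\ &\quad -I_1^2I_4h+I_1h+2I_2I_3hg-I_2I_4I_5g^2-I_5h^2+2I_1I_3hg-2I_1I_2I_3hg-2I_1I_3h^2-I_2^2h\\ &\quad +I_3h^2-2I_3hg-I_4I_5hg-I_1I_2I_5h^2+I_2^2I_3g^2+I_1I_5h^2+I_4g,\end{aligned}$$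 $$\begin{aligned} \varphi_2(r)={}&1+I_5h-3I_2I_5h+I_1I_3h+I_3g-3I_2I_3g+I_4I_5g-I_3h-I_1I_4^2I_5g+3I_2^2I_3g-2I_2I_4I_5g+2I_2I_3h\\ &\quad -I_2^3I_5h+I_1I_2^2I_3h-I_2^3I_3g+3I_2^2I_5h+I_4I_5h-I_2I_4I_5h+2I_1I_3I_4h+I_3I_4g\\ &\quad -I_2I_3I_4g+I_4^2+2I_2^2I_4+I_2^4+I_1I_2I_4I_5h-I_1^2I_3I_4h-I_1I_3I_4g+I_1I_2I_3I_4g\\ &\quad -I_2^2I_3h-2I_1I_2^2I_4-2I_1I_4^2+I_1^2I_4^2+2I_4-2I_1I_4-4I_2I_4+4I_1I_2I_4-4I_2\\ &\quad +I_4^2I_5g+I_2^2I_4I_5g-2I_1I_2I_3h-I_3I_4h+6I_2^2-4I_2^3-I_1I_4I_5h,\end{aligned}$$ $$\begin{aligned} \psi_2(r)={}&h+I_3hg-2I_2I_4g+I_5h^2-3I_2h-2I_2I_3hg-I_1I_2I_3h^2+I_4g+3I_2^2h+I_2^2I_4g+I_2^2I_5h^2-I_2^3h\\ &\quad -I_3I_4hg+I_4^2g+I_4h-I_2I_4h-2I_2I_5h^2-I_1I_4h+I_1I_2I_4h+I_1I_3h^2+I_3I_4g^2\\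 &\quad +I_2I_3h^2-I_3h^2+I_1I_3I_4hg-I_2I_3I_4g^2-2I_2I_4I_5hg+2I_4I_5hg+I_2^2I_3hg-I_1I_4^2g\\ &\quad +I_4^2I_5g^2.\end{aligned}$$ Suppose that $\varphi_2(r)>0$ for all $r\in[0,1)$. Let $W(\nu)$, $0\le\nu\le1$, be a standard Wiener process on some probability space and let $$U(\nu)=W(\nu)-\int_0^1 g(r)\,dW(r)\int_0^\nu h(r)\,dr,\qquad 0\le\nu\le1 .$$ Here integrals of deterministic functions with respect to $W$ and $U$ are mean-square limits of Riemann--Stieltjes sums over tagged partitions whose mesh tends to $0$. These integrals exist, the process $r\mapsto\int_0^r\frac{\varphi_1(r)h(q)+\psi_2(r)g(q)}{\varphi_2(r)}\,dU(q)$, $0\le r<1$, has a jointly measurable version, and for every such version the process $$L[U](\nu)=U(\nu)+\int_0^{\nu}\left(\int_0^r\frac{\varphi_1(r)h(q)+\psi_2(r)g(q)}{\varphi_2(r)}\,dU(q)\right)dr,\qquad 0\le\nu\le1,$$ is well defined outside a null set (for $\nu<1$ the outer integral is a Lebesgue integral along the path; for $\nu=1$, where the integrand may be singular, it is the convergent improper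 integral $\lim_{\nu\uparrow1}\int_0^\nu$), and coincides outside a null set with a standard Wiener process $w_\nu$, $0\le\nu\le1$. -/

import Mathlib

open MeasureTheory ProbabilityTheory Set Filter Topology

namespace MDE

/-- A (standard) Wiener process on the time interval `[0, 1]`: it starts from `0`, has independent
increments, `W t - W s` is centred Gaussian with variance `t - s`, and almost every path is
continuous. Processes are indexed by `ℝ`; only the times in `[0, 1]` matter. -/
structure IsWienerProcess {Ω : Type*} [MeasurableSpace Ω] (W : ℝ → Ω → ℝ) (P : Measure Ω) :
    Prop where
  zero : ∀ᵐ ω ∂P, W 0 ω = 0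
  indep : HasIndepIncrements (fun t : Icc (0 : ℝ) 1 ↦ W t) P
  law : ∀ s t : ℝ, 0 ≤ s → s ≤ t → t ≤ 1 →
    HasLaw (fun ω ↦ W t ω - W s ω) (gaussianReal 0 (t - s).toNNReal) P
  cont : ∀ᵐ ω ∂P, ContinuousOn (fun t ↦ W t ω) (Icc 0 1)

/-- For `a ≤ b`, the random variable `J` is (a version of) the stochastic integral
`∫_a^b f(q) dX(q)` of the deterministic function `f`: the mean square limit of the
Riemann-Stieltjes sums over the tagged partitions `a = t 0 ≤ t 1 ≤ ⋯ ≤ t n = b`,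
`τ i ∈ [t i, t (i + 1)]`, as the mesh tends to `0`. -/
structure HasStochIntegral {Ω : Type*} [MeasurableSpace Ω] (P : Measure Ω) (X : ℝ → Ω → ℝ)
    (f : ℝ → ℝ) (a b : ℝ) (J : Ω → ℝ) : Prop where
  memLp : MemLp J 2 P
  tendsto : ∀ ε : ℝ, 0 < ε → ∃ δ : ℝ, 0 < δ ∧
    ∀ (n : ℕ) (t τ : ℕ → ℝ), Monotone t → t 0 = a → t n = b →
      (∀ i < n, t (i + 1) - t i < δ) → (∀ i < n, τ i ∈ Icc (t i) (t (i + 1))) →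
      eLpNorm (fun ω ↦ (∑ i ∈ Finset.range n, f (τ i) * (X (t (i + 1)) ω - X (t i) ω)) - J ω) 2 P
        < ENNReal.ofReal ε

/-- `I₁(r) = ∫_0^r g²` -/
noncomputable def int1 (g : ℝ → ℝ) (r : ℝ) : ℝ := ∫ q in (0 : ℝ)..r, g q ^ 2

/-- `I₂(r) = ∫_0^r h g` -/
noncomputable def int2 (h g : ℝ → ℝ) (r : ℝ) : ℝ := ∫ q in (0 : ℝ)..r, h q * g q

/-- `I₃(r) = ∫_0^r h` -/
noncomputable def int3 (h : ℝ → ℝ) (r : ℝ) : ℝ := ∫ q in (0 : ℝ)..r, h q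

/-- `I₄(r) = ∫_0^r h²` -/
noncomputable def int4 (h : ℝ → ℝ) (r : ℝ) : ℝ := ∫ q in (0 : ℝ)..r, h q ^ 2

/-- `I₅(r) = ∫_0^r g` -/
noncomputable def int5 (g : ℝ → ℝ) (r : ℝ) : ℝ := ∫ q in (0 : ℝ)..r, g q

/-- The polynomial expression of `φ₁` in the partial integrals and in `h = h(r)`, `g = g(r)`. -/
def phi1Poly (I1 I2 I3 I4 I5 h g : ℝ) : ℝ :=
  g - h - 3 * I2 * g + I5 * h * g + I3 * g ^ 2 + 2 * I2 * h - 2 * I2 * I3 * g ^ 2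
    + I1 * I2 ^ 2 * h + I4 * I5 * g ^ 2 - I2 ^ 3 * g - I2 * I4 * g + 3 * I2 ^ 2 * g
    + I2 * I5 * h ^ 2 - 2 * I2 * I5 * h * g - 2 * I1 * I2 * h + I2 ^ 2 * I5 * h * g
    + I1 ^ 2 * I3 * h ^ 2 - I4 * h + 2 * I1 * I4 * h - I1 * I4 * g + I1 * I2 * I4 * g
    + I1 * I4 * I5 * h * g - I1 ^ 2 * I4 * h + I1 * h + 2 * I2 * I3 * h * g
    - I2 * I4 * I5 * g ^ 2 - I5 * h ^ 2 + 2 * I1 * I3 * h * g - 2 * I1 * I2 * I3 * h * g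
    - 2 * I1 * I3 * h ^ 2 - I2 ^ 2 * h + I3 * h ^ 2 - 2 * I3 * h * g - I4 * I5 * h * g
    - I1 * I2 * I5 * h ^ 2 + I2 ^ 2 * I3 * g ^ 2 + I1 * I5 * h ^ 2 + I4 * g

/-- The polynomial expression of `φ₂` in the partial integrals and in `h = h(r)`, `g = g(r)`. -/
def phi2Poly (I1 I2 I3 I4 I5 h g : ℝ) : ℝ :=
  1 + I5 * h - 3 * I2 * I5 * h + I1 * I3 * h + I3 * g - 3 * I2 * I3 * g + I4 * I5 * g - I3 * h
    - I1 * I4 ^ 2 * I5 * g + 3 * I2 ^ 2 * I3 * g - 2 * I2 * I4 * I5 * g + 2 * I2 * I3 * h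
    - I2 ^ 3 * I5 * h + I1 * I2 ^ 2 * I3 * h - I2 ^ 3 * I3 * g + 3 * I2 ^ 2 * I5 * h
    + I4 * I5 * h - I2 * I4 * I5 * h + 2 * I1 * I3 * I4 * h + I3 * I4 * g - I2 * I3 * I4 * g
    + I4 ^ 2 + 2 * I2 ^ 2 * I4 + I2 ^ 4 + I1 * I2 * I4 * I5 * h - I1 ^ 2 * I3 * I4 * h
    - I1 * I3 * I4 * g + I1 * I2 * I3 * I4 * g - I2 ^ 2 * I3 * h - 2 * I1 * I2 ^ 2 * I4
    - 2 * I1 * I4 ^ 2 + I1 ^ 2 * I4 ^ 2 + 2 * I4 - 2 * I1 * I4 - 4 * I2 * I4 + 4 * I1 * I2 * I4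
    - 4 * I2 + I4 ^ 2 * I5 * g + I2 ^ 2 * I4 * I5 * g - 2 * I1 * I2 * I3 * h - I3 * I4 * h
    + 6 * I2 ^ 2 - 4 * I2 ^ 3 - I1 * I4 * I5 * h

/-- The polynomial expression of `ψ₂` in the partial integrals and in `h = h(r)`, `g = g(r)`. -/
def psi2Poly (I1 I2 I3 I4 I5 h g : ℝ) : ℝ :=
  h + I3 * h * g - 2 * I2 * I4 * g + I5 * h ^ 2 - 3 * I2 * h - 2 * I2 * I3 * h * g
    - I1 * I2 * I3 * h ^ 2 + I4 * g + 3 * I2 ^ 2 * h + I2 ^ 2 * I4 * g + I2 ^ 2 * I5 * h ^ 2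
    - I2 ^ 3 * h - I3 * I4 * h * g + I4 ^ 2 * g + I4 * h - I2 * I4 * h - 2 * I2 * I5 * h ^ 2
    - I1 * I4 * h + I1 * I2 * I4 * h + I1 * I3 * h ^ 2 + I3 * I4 * g ^ 2 + I2 * I3 * h ^ 2
    - I3 * h ^ 2 + I1 * I3 * I4 * h * g - I2 * I3 * I4 * g ^ 2 - 2 * I2 * I4 * I5 * h * g
    + 2 * I4 * I5 * h * g + I2 ^ 2 * I3 * h * g - I1 * I4 ^ 2 * g + I4 ^ 2 * I5 * g ^ 2

/-- The function `φ₁`. -/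
noncomputable def phi1 (h g : ℝ → ℝ) (r : ℝ) : ℝ :=
  phi1Poly (int1 g r) (int2 h g r) (int3 h r) (int4 h r) (int5 g r) (h r) (g r)

/-- The function `φ₂`. -/
noncomputable def phi2 (h g : ℝ → ℝ) (r : ℝ) : ℝ :=
  phi2Poly (int1 g r) (int2 h g r) (int3 h r) (int4 h r) (int5 g r) (h r) (g r)

/-- The function `ψ₂`. -/
noncomputable def psi2 (h g : ℝ → ℝ) (r : ℝ) : ℝ :=
  psi2Poly (int1 g r) (int2 h g r) (int3 h r) (int4 h r) (int5 g r) (h r) (g r)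

/-- The Volterra kernel `(φ₁(r) h(q) + ψ₂(r) g(q)) / φ₂(r)`. -/
noncomputable def kernel (h g : ℝ → ℝ) (r q : ℝ) : ℝ :=
  (phi1 h g r * h q + psi2 h g r * g q) / phi2 h g r

/-- The process `U(ν) = W(ν) - ξ ∫_0^ν h(r) dr`, where `ξ` is meant to be `∫_0^1 g dW`. -/
noncomputable def limitProcess {Ω : Type*} (W : ℝ → Ω → ℝ) (ξ : Ω → ℝ) (h : ℝ → ℝ)
    (ν : ℝ) (ω : Ω) : ℝ :=
  W ν ω - ξ ω * ∫ r in (0 : ℝ)..ν, h r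

/-- `Y` is a jointly measurable version of the process
`r ↦ ∫_0^r (φ₁(r) h(q) + ψ₂(r) g(q)) / φ₂(r) dU(q)`, `0 ≤ r < 1`. -/
structure IsInnerIntegral {Ω : Type*} [MeasurableSpace Ω] (P : Measure Ω) (h g : ℝ → ℝ)
    (U Y : ℝ → Ω → ℝ) : Prop where
  measurable : Measurable (Function.uncurry Y)
  integral : ∀ r ∈ Ico (0 : ℝ) 1, HasStochIntegral P U (kernel h g r) 0 r (Y r)

/-- `w` is the transformed process `L[U](ν) = U(ν) + ∫_0^ν Y(r) dr`, `0 ≤ ν ≤ 1`, up to a null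
set. For `ν < 1` the integral is a Lebesgue integral along the path (and exists); for `ν = 1`,
where the integrand may be singular, it is the improper integral (and exists). -/
def IsTransform {Ω : Type*} [MeasurableSpace Ω] (P : Measure Ω) (U Y w : ℝ → Ω → ℝ) : Prop :=
  ∀ᵐ ω ∂P,
    (∀ ν ∈ Ico (0 : ℝ) 1, IntervalIntegrable (fun r ↦ Y r ω) volume 0 ν ∧
      w ν ω = U ν ω + ∫ r in (0 : ℝ)..ν, Y r ω) ∧
    ∃ I : ℝ, Tendsto (fun ν ↦ ∫ r in (0 : ℝ)..ν, Y r ω) (𝓝[<] 1) (𝓝 I) ∧ w 1 ω = U 1 ω + I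

end MDE

/-!
The Wiener integral of `W` is a linear isometry `J : L²(0, 1) → L²(P)` with `J 1_(0, t] = W t`, all
of whose values are centred Gaussian. Put `T φ = φ - ⟨h, φ⟩ g`. Then `U t = J (T 1_(0, t])`, and for
continuous `f` the Riemann–Stieltjes integral `∫_0^r f dU` is `J (T (f 1_(0, r]))`, because step
functions converge to `f` in `L²(0, 1)`. The statement thus becomes one about the vectors
`v t = T 1_(0, t] + ∫_0^t T k_r dr` of `L²(0, 1)`, where
`k_r = (a(r) h + b(r) g) 1_(0, r]`, `a = φ₁ / φ₂` and `b = ψ₂ / φ₂`.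

The kernel is the innovation kernel of `U`. The polynomials are such that, by a polynomial identity
(`phi_system_fst`, `phi_system_snd`), `a` and `b` solve the linear system `KernelSystem`; this
system says that `k_r` cancels the correlation of `dU(r)` with the past of `U`, since
`T* T = 1 - h ⊗ g - g ⊗ h + h ⊗ h`. Hence increments of `v` are orthogonal to the past
(`inner_innovVec_innovVec_sub`), and as they have the quadratic variation of `U`
(`exists_norm_innovVec_sub_sq_le`), `⟨v s, v t⟩ = min s t` for `s, t < 1` (`inner_innovVec`).

The law of a family of Wiener integrals is determined by its Gram matrix
(`IsWienerIntegral.map_eq_of_gram`), so the transformed process has the finite-dimensional laws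
of `W`. The integral along the paths is the Bochner integral in `L²(P)` (`integral_version`).
At time `1` the kernel may be singular; the left limit of the paths nevertheless exists, because
being Cauchy at `1` along the rationals is an event that depends on the law alone, and the paths
of `W` have this property (`IsWienerIntegral.exists_tendsto`).
-/

open scoped ENNReal NNReal RealInnerProductSpace

namespace MDE

/-! ### The Hilbert space `L²(0, 1)` and its truncated functions -/

/-- Lebesgue measure on `(0, 1]`. -/
noncomputable abbrev unitMeasure : Measure ℝ := volume.restrict (Ioc (0 : ℝ) 1)

/-- The Hilbert space `L²(0, 1)`. -/
abbrev L2I : Type := Lp ℝ 2 unitMeasure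

lemma memLp_cut (f : C(ℝ, ℝ)) (r : ℝ) : MemLp ((Ioc 0 r).indicator f) 2 unitMeasure := by
  obtain ⟨C, hC⟩ := (isCompact_Icc (a := (0 : ℝ)) (b := 1)).exists_bound_of_continuousOn
    f.continuous.continuousOn
  refine MemLp.indicator measurableSet_Ioc (MemLp.of_bound (C := C)
    f.continuous.aestronglyMeasurable ?_)
  filter_upwards [ae_restrict_mem measurableSet_Ioc] with q hq using hC q ⟨hq.1.le, hq.2⟩

/-- The element `f · 1_(0, r]` of `L²(0, 1)`. -/
noncomputable def cut (f : C(ℝ, ℝ)) (r : ℝ) : L2I := (memLp_cut f r).toLp _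

lemma coeFn_cut (f : C(ℝ, ℝ)) (r : ℝ) : cut f r =ᵐ[unitMeasure] (Ioc 0 r).indicator f :=
  (memLp_cut f r).coeFn_toLp

lemma inner_cut_left (f : C(ℝ, ℝ)) {r : ℝ} (h0 : 0 ≤ r) (h1 : r ≤ 1) (φ : L2I) :
    ⟪cut f r, φ⟫ = ∫ q in (0 : ℝ)..r, f q * φ q := by
  rw [L2.inner_def (𝕜 := ℝ), intervalIntegral.integral_of_le h0]
  have : Ioc 0 r = Ioc 0 r ∩ Ioc 0 1 := by
    ext x; simp only [mem_Ioc, mem_inter_iff]; grind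
  rw [this, ← Measure.restrict_restrict measurableSet_Ioc]
  have key : (fun q ↦ ⟪cut f r q, φ q⟫) =ᵐ[unitMeasure]
      (Ioc 0 r).indicator fun q ↦ f q * φ q := by
    filter_upwards [coeFn_cut f r] with q hq
    rw [hq]
    by_cases h : q ∈ Ioc 0 r <;> simp [h, mul_comm]
  exact (integral_congr_ae key).trans (integral_indicator measurableSet_Ioc)

lemma inner_cut (f e : C(ℝ, ℝ)) {r s : ℝ} (hr : r ∈ Icc (0 : ℝ) 1) (hs : s ∈ Icc (0 : ℝ) 1) :
    ⟪cut f r, cut e s⟫ = ∫ q in (0 : ℝ)..min r s, f q * e q := by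
  wlog h : r ≤ s generalizing f e r s
  · rw [real_inner_comm, this e f hs hr (by linarith), min_comm]
    simp_rw [mul_comm]
  rw [inner_cut_left f hr.1 hr.2, min_eq_left h]
  rw [intervalIntegral.integral_of_le hr.1, intervalIntegral.integral_of_le hr.1]
  refine setIntegral_congr_ae measurableSet_Ioc ?_
  have := coeFn_cut e s
  rw [Filter.EventuallyEq, ae_restrict_iff' measurableSet_Ioc] at this
  filter_upwards [this] with q hq hq'
  rw [hq ⟨hq'.1, hq'.2.trans hr.2⟩, indicator_of_mem]
  exact ⟨hq'.1, hq'.2.trans h⟩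

lemma inner_cut_one {r s : ℝ} (hr : r ∈ Icc (0 : ℝ) 1) (hs : s ∈ Icc (0 : ℝ) 1) :
    ⟪cut 1 r, cut 1 s⟫ = min r s := by
  simp [inner_cut 1 1 hr hs]

lemma cut_zero_right (f : C(ℝ, ℝ)) : cut f 0 = 0 := by
  have := coeFn_cut f 0
  refine Lp.ext ?_
  filter_upwards [this, Lp.coeFn_zero ℝ 2 unitMeasure] with q h1 h2
  rw [h1, h2]; simp

lemma cut_add (f e : C(ℝ, ℝ)) (r : ℝ) : cut (f + e) r = cut f r + cut e r := by
  unfold cut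
  rw [← MemLp.toLp_add]
  congr 1
  exact indicator_add' _ _ _

lemma cut_smul (c : ℝ) (f : C(ℝ, ℝ)) (r : ℝ) : cut (c • f) r = c • cut f r := by
  unfold cut
  rw [← MemLp.toLp_const_smul]
  congr 1
  exact indicator_const_smul (Ioc 0 r) c (f : ℝ → ℝ)

lemma norm_cut_sub_sq (f : C(ℝ, ℝ)) {r s : ℝ} (hr : 0 ≤ r) (hrs : r ≤ s) (hs : s ≤ 1) :
    ‖cut f s - cut f r‖ ^ 2 = ∫ q in r..s, f q ^ 2 := by
  have hr' : r ∈ Icc (0 : ℝ) 1 := ⟨hr, hrs.trans hs⟩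
  have hs' : s ∈ Icc (0 : ℝ) 1 := ⟨hr.trans hrs, hs⟩
  have hi : ∀ a b, IntervalIntegrable (fun q ↦ f q * f q) volume a b := fun a b ↦
    Continuous.intervalIntegrable (by fun_prop) a b
  rw [norm_sub_sq_real, ← real_inner_self_eq_norm_sq, ← real_inner_self_eq_norm_sq,
    inner_cut _ _ hs' hs', inner_cut _ _ hr' hr', inner_cut _ _ hs' hr', min_self, min_self,
    min_eq_right hrs, ← intervalIntegral.integral_add_adjacent_intervals (hi 0 r) (hi r s)]
  simp_rw [sq]
  ring

lemma norm_cut_sub_sq_le (f : C(ℝ, ℝ)) {C : ℝ} (hC : ∀ q ∈ Icc (0 : ℝ) 1, |f q| ≤ C) {r s : ℝ}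
    (hr : r ∈ Icc (0 : ℝ) 1) (hs : s ∈ Icc (0 : ℝ) 1) :
    ‖cut f s - cut f r‖ ^ 2 ≤ C ^ 2 * |s - r| := by
  wlog h : r ≤ s generalizing r s
  · rw [norm_sub_rev, abs_sub_comm]
    exact this hs hr (by linarith)
  rw [norm_cut_sub_sq f hr.1 h hs.2, abs_of_nonneg (sub_nonneg.2 h)]
  have hc : IntervalIntegrable (fun q ↦ f q ^ 2) volume r s :=
    Continuous.intervalIntegrable (by fun_prop) r s
  calc ∫ q in r..s, f q ^ 2 ≤ ∫ q in r..s, C ^ 2 := by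
        refine intervalIntegral.integral_mono_on h hc (by simp) fun q hq ↦ ?_
        have := hC q ⟨hr.1.trans hq.1, hq.2.trans hs.2⟩
        exact sq_le_sq' (by linarith [neg_abs_le (f q)]) ((le_abs_self _).trans this)
    _ = C ^ 2 * (s - r) := by simp [mul_comm]

lemma continuousOn_cut (f : C(ℝ, ℝ)) : ContinuousOn (cut f) (Icc 0 1) := by
  obtain ⟨C, hC⟩ := (isCompact_Icc (a := (0 : ℝ)) (b := 1)).exists_bound_of_continuousOn
    f.continuous.continuousOn
  intro r hr
  rw [ContinuousWithinAt, tendsto_iff_norm_sub_tendsto_zero]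
  have h1 : Tendsto (fun s ↦ √(C ^ 2 * |s - r|)) (𝓝[Icc 0 1] r) (𝓝 0) := by
    have : Continuous (fun s ↦ √(C ^ 2 * |s - r|)) := by fun_prop
    simpa using (this.tendsto r).mono_left nhdsWithin_le_nhds
  refine tendsto_of_tendsto_of_tendsto_of_le_of_le' tendsto_const_nhds h1
    (Eventually.of_forall fun _ ↦ norm_nonneg _) ?_
  filter_upwards [self_mem_nhdsWithin] with s hs
  exact Real.le_sqrt_of_sq_le (norm_cut_sub_sq_le f hC hr hs)

/-- The functions `1_(0, t]` are total in `L²(0, 1)`: a function orthogonal to all of them has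
vanishing primitive, hence vanishes almost everywhere. -/
lemma eq_zero_of_inner_cut_one {φ : L2I} (h : ∀ t ∈ Icc (0 : ℝ) 1, ⟪cut 1 t, φ⟫ = 0) : φ = 0 := by
  have hint : Integrable φ unitMeasure := (Lp.memLp φ).integrable (by norm_num)
  have hii : IntervalIntegrable φ volume 0 1 := by
    rw [intervalIntegrable_iff_integrableOn_Ioc_of_le zero_le_one]; exact hint
  have h0 : ∀ t ∈ Icc (0 : ℝ) 1, ∫ q in (0 : ℝ)..t, φ q = 0 := fun t ht ↦ by
    have := h t ht
    rw [inner_cut_left _ ht.1 ht.2] at this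
    simpa using this
  refine Lp.ext (EventuallyEq.trans ?_ (Lp.coeFn_zero ℝ 2 unitMeasure).symm)
  rw [Filter.EventuallyEq, ae_restrict_iff' measurableSet_Ioc]
  have h1 : ∀ᵐ q : ℝ, q ≠ 1 := by simp [ae_iff]
  filter_upwards [hii.ae_hasDerivAt_integral, h1] with q hq hq1 hq01
  have hq' : q ∈ Ioo (0 : ℝ) 1 := ⟨hq01.1, lt_of_le_of_ne hq01.2 hq1⟩
  have hd := hq (by rw [uIcc_of_le zero_le_one]; exact ⟨hq01.1.le, hq01.2⟩) 0
    (by rw [uIcc_of_le zero_le_one]; exact ⟨le_rfl, zero_le_one⟩)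
  refine hd.unique ((hasDerivAt_const q (0 : ℝ)).congr_of_eventuallyEq ?_)
  filter_upwards [Ioo_mem_nhds hq'.1 hq'.2] with x hx using h0 x ⟨hx.1.le, hx.2.le⟩

/-! ### Riemann–Stieltjes limits -/

/-- `j` is the limit of the Riemann–Stieltjes sums of `∫_a^b f dX` over tagged partitions whose
mesh tends to `0`, for a curve `X` in a normed space. -/
def HasRSLimit {E : Type*} [NormedAddCommGroup E] [NormedSpace ℝ E] (X : ℝ → E) (f : ℝ → ℝ)
    (a b : ℝ) (j : E) : Prop :=
  ∀ ε : ℝ, 0 < ε → ∃ δ : ℝ, 0 < δ ∧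
    ∀ (n : ℕ) (t τ : ℕ → ℝ), Monotone t → t 0 = a → t n = b →
      (∀ i < n, t (i + 1) - t i < δ) → (∀ i < n, τ i ∈ Icc (t i) (t (i + 1))) →
      ‖(∑ i ∈ Finset.range n, f (τ i) • (X (t (i + 1)) - X (t i))) - j‖ < ε

section RS

variable {E F : Type*} [NormedAddCommGroup E] [NormedSpace ℝ E] [NormedAddCommGroup F]
  [NormedSpace ℝ F]

lemma HasRSLimit.congr {X Y : ℝ → E} {f e : ℝ → ℝ} {a b : ℝ} {j : E} (h : HasRSLimit X f a b j)
    (hX : ∀ t ∈ Icc a b, X t = Y t) (hf : ∀ t ∈ Icc a b, f t = e t) : HasRSLimit Y e a b j := by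
  intro ε hε
  obtain ⟨δ, hδ, H⟩ := h ε hε
  refine ⟨δ, hδ, fun n t τ ht h0 hn hm hτ ↦ ?_⟩
  convert H n t τ ht h0 hn hm hτ using 3
  refine Finset.sum_congr rfl fun i hi ↦ ?_
  have hi' : i < n := Finset.mem_range.1 hi
  have h1 : a ≤ t i := h0 ▸ ht (Nat.zero_le i)
  have h2 : t (i + 1) ≤ b := hn ▸ ht hi'
  have h3 := ht (Nat.le_succ i)
  have h4 := hτ i hi'
  rw [hX _ ⟨h1.trans h3, h2⟩, hX _ ⟨h1, h3.trans h2⟩, hf _ ⟨h1.trans h4.1, h4.2.trans h2⟩]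

lemma HasRSLimit.map {X : ℝ → E} {f : ℝ → ℝ} {a b : ℝ} {j : E} (h : HasRSLimit X f a b j)
    (L : E →L[ℝ] F) : HasRSLimit (fun t ↦ L (X t)) f a b (L j) := by
  intro ε hε
  obtain ⟨δ, hδ, H⟩ := h (ε / (‖L‖ + 1)) (by positivity)
  refine ⟨δ, hδ, fun n t τ ht h0 hn hm hτ ↦ ?_⟩
  have := H n t τ ht h0 hn hm hτ
  simp_rw [← map_sub, ← map_smul, ← map_sum, ← map_sub]
  refine (L.le_opNorm _).trans_lt ?_
  rw [lt_div_iff₀ (by positivity)] at this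
  nlinarith [norm_nonneg ((∑ i ∈ Finset.range n, f (τ i) • (X (t (i + 1)) - X (t i))) - j)]

lemma HasRSLimit.unique {X : ℝ → E} {f : ℝ → ℝ} {a b : ℝ} (hab : a ≤ b) {j k : E}
    (hj : HasRSLimit X f a b j) (hk : HasRSLimit X f a b k) : j = k := by
  refine eq_of_forall_dist_le fun ε hε ↦ ?_
  obtain ⟨δ, hδ, H⟩ := hj (ε / 2) (by positivity)
  obtain ⟨δ', hδ', H'⟩ := hk (ε / 2) (by positivity)
  -- a uniform partition finer than both meshes, kept constant after its last point
  obtain ⟨n, hn⟩ := exists_nat_gt ((b - a) / min δ δ')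
  have hmin : 0 < min δ δ' := lt_min hδ hδ'
  have hnpos : (0 : ℝ) < n + 1 := by positivity
  let t : ℕ → ℝ := fun i ↦ a + (min i (n + 1) : ℕ) * ((b - a) / (n + 1))
  have ht : Monotone t := fun i j hij ↦ by
    have : (0 : ℝ) ≤ (b - a) / (n + 1) := div_nonneg (by linarith) hnpos.le
    have h2 : ((min i (n + 1) : ℕ) : ℝ) ≤ (min j (n + 1) : ℕ) := by
      exact_mod_cast min_le_min_right _ hij
    simp only [t]
    gcongr
  have h0 : t 0 = a := by
    have : min 0 (n + 1) = 0 := by omega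
    simp only [t, this]; simp
  have h1 : t (n + 1) = b := by
    have : ((n : ℝ) + 1) * ((b - a) / (n + 1)) = b - a := by field_simp
    simp only [t, min_self]; push_cast; linarith
  have hm : ∀ i < n + 1, t (i + 1) - t i < min δ δ' := fun i hi ↦ by
    simp only [t]
    rw [min_eq_left hi, min_eq_left (show i ≤ n + 1 by omega)]
    push_cast
    rw [div_lt_iff₀ hmin] at hn
    have : (b - a) / (n + 1) < min δ δ' := by
      rw [div_lt_iff₀ hnpos]; nlinarith
    linarith
  have hτ : ∀ i < n + 1, t i ∈ Icc (t i) (t (i + 1)) := fun i _ ↦ ⟨le_rfl, ht (Nat.le_succ i)⟩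
  have e1 := H (n + 1) t t ht h0 h1 (fun i hi ↦ (hm i hi).trans_le (min_le_left _ _)) hτ
  have e2 := H' (n + 1) t t ht h0 h1 (fun i hi ↦ (hm i hi).trans_le (min_le_right _ _)) hτ
  rw [← dist_eq_norm] at e1 e2
  have := dist_triangle_left j k (∑ i ∈ Finset.range (n + 1), f (t i) • (X (t (i + 1)) - X (t i)))
  linarith

end RS

/-- The Riemann sums of step functions converge in `L²(0, 1)`. -/
lemma hasRSLimit_cut (f : C(ℝ, ℝ)) {b : ℝ} (hb : b ∈ Icc (0 : ℝ) 1) :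
    HasRSLimit (cut 1) f 0 b (cut f b) := by
  intro ε hε
  have huc : UniformContinuousOn f (Icc 0 1) :=
    isCompact_Icc.uniformContinuousOn_of_continuous f.continuous.continuousOn
  obtain ⟨δ, hδ, H⟩ := Metric.uniformContinuousOn_iff.1 huc (ε / 2) (by positivity)
  refine ⟨δ, hδ, fun n t τ ht h0 hn hm hτ ↦ ?_⟩
  have hle : ∀ q : ℝ, ∀ i, (if q ≤ t i then (1 : ℝ) else 0) ≤ if q ≤ t (i + 1) then 1 else 0 := by
    intro q i
    have := ht (Nat.le_succ i)
    split_ifs with h1 h2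
    · exact le_rfl
    · exact absurd (h1.trans this) h2
    · exact zero_le_one
    · exact le_rfl
  have hae : ∀ᵐ q ∂unitMeasure, ‖((∑ i ∈ Finset.range n, f (τ i) • (cut 1 (t (i + 1)) - cut 1 (t i)))
      - cut f b : L2I) q‖ ≤ ε / 2 := by
    have hs : ∀ᵐ q ∂unitMeasure, ∀ i, cut 1 (t i) q = (Ioc 0 (t i)).indicator 1 q :=
      ae_all_iff.2 fun i ↦ coeFn_cut 1 (t i)
    have hsum : ∀ m : ℕ, ∀ᵐ q ∂unitMeasure,
        (∑ i ∈ Finset.range m, f (τ i) • (cut 1 (t (i + 1)) - cut 1 (t i)) : L2I) q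
        = ∑ i ∈ Finset.range m, f (τ i) * (cut 1 (t (i + 1)) q - cut 1 (t i) q) := by
      intro m
      induction m with
      | zero =>
        filter_upwards [Lp.coeFn_zero ℝ 2 unitMeasure] with q hq
        simpa using hq
      | succ m ih =>
        rw [Finset.sum_range_succ]
        filter_upwards [ih, Lp.coeFn_add (∑ i ∈ Finset.range m, f (τ i) •
          (cut 1 (t (i + 1)) - cut 1 (t i))) (f (τ m) • (cut 1 (t (m + 1)) - cut 1 (t m))),
          Lp.coeFn_smul (f (τ m)) (cut 1 (t (m + 1)) - cut 1 (t m)),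
          Lp.coeFn_sub (cut 1 (t (m + 1))) (cut 1 (t m))] with q h1 h2 h3 h4
        rw [h2, Pi.add_apply, h1, h3, Pi.smul_apply, h4, Finset.sum_range_succ]
        simp
    filter_upwards [hs, hsum n, coeFn_cut f b, ae_restrict_mem measurableSet_Ioc,
      Lp.coeFn_sub (∑ i ∈ Finset.range n, f (τ i) • (cut 1 (t (i + 1)) - cut 1 (t i)))
        (cut f b)] with q h1 h2 h3 hq h4
    rw [h4, Pi.sub_apply, h2, h3]
    have hone : ∀ i, cut 1 (t i) q = if q ≤ t i then 1 else 0 := fun i ↦ by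
      rw [h1, indicator_apply]; simp [hq.1]
    simp_rw [hone]
    have htel : (Ioc 0 b).indicator f q = ∑ i ∈ Finset.range n,
        f q * ((if q ≤ t (i + 1) then 1 else 0) - if q ≤ t i then 1 else 0) := by
      rw [← Finset.mul_sum, Finset.sum_range_sub (fun i ↦ if q ≤ t i then (1 : ℝ) else 0), hn, h0,
        if_neg (not_le.2 hq.1), indicator_apply]
      simp [hq.1]
    rw [htel, ← Finset.sum_sub_distrib]
    calc _ ≤ ∑ i ∈ Finset.range n,
          ε / 2 * ((if q ≤ t (i + 1) then 1 else 0) - if q ≤ t i then 1 else 0) := by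
          refine norm_sum_le_of_le _ fun i hi ↦ ?_
          have hi' : i < n := Finset.mem_range.1 hi
          rw [← sub_mul, norm_mul, Real.norm_of_nonneg (sub_nonneg.2 (hle q i))]
          by_cases hqi : q ≤ t i
          · have : q ≤ t (i + 1) := hqi.trans (ht (Nat.le_succ i))
            simp [hqi, this]
          by_cases hqi' : q ≤ t (i + 1)
          · simp only [hqi, hqi', if_true, if_false, sub_zero, mul_one]
            have a1 : 0 ≤ t i := h0 ▸ ht (Nat.zero_le i)
            have a2 : t (i + 1) ≤ b := hn ▸ ht hi'
            have a3 := hτ i hi'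
            rw [← dist_eq_norm]
            refine (H (τ i) ⟨a1.trans a3.1, a3.2.trans (a2.trans hb.2)⟩ q ⟨hq.1.le, hq.2⟩ ?_).le
            rw [Real.dist_eq, abs_lt]
            have := hm i hi'
            constructor <;> linarith [a3.1, a3.2]
          · simp [hqi, hqi']
      _ ≤ ε / 2 := by
          rw [← Finset.mul_sum, Finset.sum_range_sub (fun i ↦ if q ≤ t i then (1 : ℝ) else 0), h0,
            if_neg (not_le.2 hq.1), sub_zero]
          split_ifs <;> linarith
  have := Lp.norm_le_of_ae_bound (by positivity) hae
  refine this.trans_lt ?_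
  simp [measureUnivNNReal]
  linarith


/-! ### The perturbation operator and the innovation vectors -/

/-- The operator `φ ↦ φ - ⟨h, φ⟩ g` of `L²(0, 1)`: the process `U` is the image of the Wiener
process under it, in the sense that `∫ f dU = ∫ T f dW`. -/
noncomputable def pert (h g : C(ℝ, ℝ)) : L2I →L[ℝ] L2I :=
  ContinuousLinearMap.id ℝ L2I - (innerSL ℝ (cut h 1)).smulRight (cut g 1)

lemma pert_apply (h g : C(ℝ, ℝ)) (φ : L2I) : pert h g φ = φ - ⟪cut h 1, φ⟫ • cut g 1 := by
  simp [pert]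

/-- `T* T = 1 - h ⊗ g - g ⊗ h + h ⊗ h` for the perturbation operator `T`, as `‖g‖ = 1`. -/
lemma inner_pert {h g : C(ℝ, ℝ)} (hg : ∫ q in (0 : ℝ)..1, g q ^ 2 = 1) (φ ψ : L2I) :
    ⟪pert h g φ, pert h g ψ⟫ = ⟪φ, ψ⟫ - ⟪cut h 1, φ⟫ * ⟪cut g 1, ψ⟫ - ⟪cut g 1, φ⟫ * ⟪cut h 1, ψ⟫
      + ⟪cut h 1, φ⟫ * ⟪cut h 1, ψ⟫ := by
  have h1 : ⟪cut g 1, cut g 1⟫ = (1 : ℝ) := by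
    rw [inner_cut _ _ (by simp) (by simp), min_self]
    simpa only [sq] using hg
  rw [pert_apply, pert_apply, inner_sub_left, inner_sub_right, inner_sub_right]
  simp only [inner_smul_left, inner_smul_right, h1, real_inner_comm φ (cut g 1)]
  simp
  ring

/-- The element `a(r) h 1_(0, r] + b(r) g 1_(0, r]` of `L²(0, 1)`. -/
noncomputable def kerVec (h g : C(ℝ, ℝ)) (a b : ℝ → ℝ) (r : ℝ) : L2I :=
  a r • cut h r + b r • cut g r

/-- The linear system that determines the coefficients `a`, `b` of the Volterra kernel
`a(r) h(q) + b(r) g(q)`. -/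
structure KernelSystem (h g : C(ℝ, ℝ)) (a b : ℝ → ℝ) : Prop where
  norm : ∫ q in (0 : ℝ)..1, g q ^ 2 = 1
  contA : ContinuousOn a (Ico 0 1)
  contB : ContinuousOn b (Ico 0 1)
  eqH : ∀ r ∈ Ico (0 : ℝ) 1,
    a r * (1 - int2 h g r + int4 h r) + b r * (int2 h g r - int1 g r) = g r - h r
  eqG : ∀ r ∈ Ico (0 : ℝ) 1, -a r * int4 h r + b r * (1 - int2 h g r) = h r

lemma continuousOn_kerVec {h g : C(ℝ, ℝ)} {a b : ℝ → ℝ} (ha : ContinuousOn a (Ico 0 1))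
    (hb : ContinuousOn b (Ico 0 1)) : ContinuousOn (kerVec h g a b) (Ico 0 1) :=
  (ha.smul ((continuousOn_cut h).mono Ico_subset_Icc_self)).add
    (hb.smul ((continuousOn_cut g).mono Ico_subset_Icc_self))

/-- The element of `L²(0, 1)` whose Wiener integral is the transformed process at time `t`. -/
noncomputable def innovVec (h g : C(ℝ, ℝ)) (a b : ℝ → ℝ) (t : ℝ) : L2I :=
  pert h g (cut 1 t) + ∫ r in (0 : ℝ)..t, pert h g (kerVec h g a b r)

section

variable {h g : C(ℝ, ℝ)} {a b : ℝ → ℝ}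

lemma continuousOn_pert_kerVec (K : KernelSystem h g a b) :
    ContinuousOn (fun r ↦ pert h g (kerVec h g a b r)) (Ico 0 1) :=
  (pert h g).continuous.comp_continuousOn (continuousOn_kerVec K.contA K.contB)

lemma intervalIntegrable_pert_kerVec (K : KernelSystem h g a b) {s t : ℝ} (hs : s ∈ Ico (0 : ℝ) 1)
    (ht : t ∈ Ico (0 : ℝ) 1) :
    IntervalIntegrable (fun r ↦ pert h g (kerVec h g a b r)) volume s t := by
  refine ((continuousOn_pert_kerVec K).mono fun x hx ↦ ?_).intervalIntegrable
  rcases le_total s t with h | h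
  · rw [uIcc_of_le h] at hx; exact ⟨hs.1.trans hx.1, hx.2.trans_lt ht.2⟩
  · rw [uIcc_of_ge h] at hx; exact ⟨ht.1.trans hx.1, hx.2.trans_lt hs.2⟩

lemma innovVec_sub (K : KernelSystem h g a b) {s t : ℝ} (hs : s ∈ Ico (0 : ℝ) 1)
    (ht : t ∈ Ico (0 : ℝ) 1) :
    innovVec h g a b t - innovVec h g a b s = pert h g (cut 1 t - cut 1 s) +
      ∫ r in s..t, pert h g (kerVec h g a b r) := by
  have h0 : (0 : ℝ) ∈ Ico (0 : ℝ) 1 := by simp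
  rw [innovVec, innovVec, ← intervalIntegral.integral_add_adjacent_intervals
    (intervalIntegrable_pert_kerVec K h0 hs) (intervalIntegrable_pert_kerVec K hs ht), map_sub]
  abel

lemma inner_cut_one_left (f e : C(ℝ, ℝ)) {s : ℝ} (hs : s ∈ Icc (0 : ℝ) 1) :
    ⟪cut f 1, cut e s⟫ = ∫ q in (0 : ℝ)..s, f q * e q := by
  rw [inner_cut _ _ (by simp) hs, min_eq_right hs.2]

/-- The correlation of `∫_0^s f dU` with the inner integral at a later time `r`. It cancels the
correlation with the increment `dU(r)`, by the linear system. -/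
lemma inner_pert_cut_pert_kerVec (K : KernelSystem h g a b) (f : C(ℝ, ℝ)) {s r : ℝ} (hs : 0 ≤ s)
    (hsr : s ≤ r) (hr : r < 1) :
    ⟪pert h g (cut f s), pert h g (kerVec h g a b r)⟫ =
      ⟪cut h 1, cut f s⟫ * (g r - h r) + ⟪cut g 1, cut f s⟫ * h r := by
  have hr' : r ∈ Ico (0 : ℝ) 1 := ⟨hs.trans hsr, hr⟩
  have hr'' : r ∈ Icc (0 : ℝ) 1 := ⟨hs.trans hsr, hr.le⟩
  have hs' : s ∈ Icc (0 : ℝ) 1 := ⟨hs, hsr.trans hr.le⟩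
  have e1 : ∀ e : C(ℝ, ℝ), ⟪cut f s, cut e r⟫ = ⟪cut e 1, cut f s⟫ := fun e ↦ by
    rw [inner_cut _ _ hs' hr'', inner_cut_one_left _ _ hs', min_eq_left hsr]
    simp_rw [mul_comm]
  have i1 : ⟪cut g 1, cut g r⟫ = int1 g r := by
    rw [inner_cut_one_left _ _ hr'', int1]; simp_rw [sq]
  have i2 : ⟪cut h 1, cut g r⟫ = int2 h g r := by
    rw [inner_cut_one_left _ _ hr'', int2]
  have i2' : ⟪cut g 1, cut h r⟫ = int2 h g r := by
    rw [inner_cut_one_left _ _ hr'', int2]; simp_rw [mul_comm]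
  have i4 : ⟪cut h 1, cut h r⟫ = int4 h r := by
    rw [inner_cut_one_left _ _ hr'', int4]; simp_rw [sq]
  rw [inner_pert K.norm, kerVec]
  simp only [inner_add_right, inner_smul_right, e1, i1, i2, i2', i4]
  rw [← K.eqH r hr', ← K.eqG r hr']
  ring

/-- The increments of the transformed process are orthogonal to the past of `U`. -/
lemma inner_pert_cut_innovVec_sub (K : KernelSystem h g a b) (f : C(ℝ, ℝ)) {s r t : ℝ}
    (hs : 0 ≤ s) (hsr : s ≤ r) (hrt : r ≤ t) (ht : t < 1) :
    ⟪pert h g (cut f s), innovVec h g a b t - innovVec h g a b r⟫ = 0 := by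
  have hr' : r ∈ Ico (0 : ℝ) 1 := ⟨hs.trans hsr, hrt.trans_lt ht⟩
  have ht' : t ∈ Ico (0 : ℝ) 1 := ⟨hr'.1.trans hrt, ht⟩
  have hr'' : r ∈ Icc (0 : ℝ) 1 := ⟨hr'.1, hr'.2.le⟩
  have ht'' : t ∈ Icc (0 : ℝ) 1 := ⟨ht'.1, ht'.2.le⟩
  have hs'' : s ∈ Icc (0 : ℝ) 1 := ⟨hs, hsr.trans hr''.2⟩
  have hint : ∀ (e : C(ℝ, ℝ)) (x y : ℝ), IntervalIntegrable e volume x y := fun e x y ↦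
    e.continuous.intervalIntegrable x y
  have hinc : ∀ e : C(ℝ, ℝ), ⟪cut e 1, cut 1 t - cut 1 r⟫ = ∫ q in r..t, e q := fun e ↦ by
    rw [inner_sub_right, inner_cut_one_left _ _ ht'', inner_cut_one_left _ _ hr'']
    simp [intervalIntegral.integral_interval_sub_left (hint e 0 t) (hint e 0 r)]
  have hz : ⟪cut f s, cut 1 t - cut 1 r⟫ = (0 : ℝ) := by
    rw [inner_sub_right, inner_cut _ _ hs'' ht'', inner_cut _ _ hs'' hr'', min_eq_left hsr,
      min_eq_left (hsr.trans hrt), sub_self]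
  rw [innovVec_sub K hr' ht', inner_add_right, inner_pert K.norm, hinc, hinc, hz,
    ← innerSL_apply_apply ℝ (pert h g (cut f s)), ← ContinuousLinearMap.intervalIntegral_comp_comm _
      (intervalIntegrable_pert_kerVec K hr' ht')]
  have : ∫ q in r..t, innerSL ℝ (pert h g (cut f s)) (pert h g (kerVec h g a b q)) =
      ∫ q in r..t, (⟪cut h 1, cut f s⟫ * (g q - h q) + ⟪cut g 1, cut f s⟫ * h q) := by
    refine intervalIntegral.integral_congr fun q hq ↦ ?_
    rw [uIcc_of_le hrt] at hq
    simp only [innerSL_apply_apply]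
    exact inner_pert_cut_pert_kerVec K f hs (hsr.trans hq.1) (hq.2.trans_lt ht)
  rw [this, intervalIntegral.integral_add (((hint g _ _).sub (hint h _ _)).const_mul _)
    ((hint h _ _).const_mul _), intervalIntegral.integral_const_mul,
    intervalIntegral.integral_const_mul, intervalIntegral.integral_sub (hint g _ _) (hint h _ _)]
  ring

lemma inner_innovVec_innovVec_sub (K : KernelSystem h g a b) {r t : ℝ} (hr : 0 ≤ r) (hrt : r ≤ t)
    (ht : t < 1) : ⟪innovVec h g a b r, innovVec h g a b t - innovVec h g a b r⟫ = 0 := by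
  have hr' : r ∈ Ico (0 : ℝ) 1 := ⟨hr, hrt.trans_lt ht⟩
  set x := innovVec h g a b t - innovVec h g a b r with hx
  rw [real_inner_comm, innovVec, inner_add_right, real_inner_comm, hx, inner_pert_cut_innovVec_sub K 1 hr le_rfl hrt ht, zero_add,
    ← innerSL_apply_apply ℝ (innovVec h g a b t - innovVec h g a b r),
    ← ContinuousLinearMap.intervalIntegral_comp_comm _
      (intervalIntegrable_pert_kerVec K (by simp) hr')]
  rw [intervalIntegral.integral_congr (g := fun _ ↦ (0 : ℝ)), intervalIntegral.integral_zero]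
  intro q hq
  rw [uIcc_of_le hr] at hq
  simp only [innerSL_apply_apply, kerVec, map_add, map_smul, inner_add_right, inner_smul_right]
  rw [real_inner_comm, inner_pert_cut_innovVec_sub K h hq.1 hq.2 hrt ht,
    real_inner_comm, inner_pert_cut_innovVec_sub K g hq.1 hq.2 hrt ht]
  simp

lemma norm_innovVec_sq_sub (K : KernelSystem h g a b) {r t : ℝ} (hr : 0 ≤ r) (hrt : r ≤ t)
    (ht : t < 1) : ‖innovVec h g a b t‖ ^ 2 - ‖innovVec h g a b r‖ ^ 2 =
      ‖innovVec h g a b t - innovVec h g a b r‖ ^ 2 := by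
  have h0 := inner_innovVec_innovVec_sub K hr hrt ht
  have : innovVec h g a b t = innovVec h g a b r + (innovVec h g a b t - innovVec h g a b r) := by
    abel
  conv_lhs => rw [this, norm_add_sq_real, h0]
  ring

/-- Locally uniformly on `[0, 1)`, the increment of the transformed process over `[r, t]` has
variance `t - r + O((t - r) ^ (3 / 2))`, as the increment of `U` does. -/
lemma exists_norm_innovVec_sub_sq_le (K : KernelSystem h g a b) {c : ℝ} (hc : c < 1) :
    ∃ C : ℝ, ∀ r t, 0 ≤ r → r ≤ t → t ≤ c →
      |‖innovVec h g a b t - innovVec h g a b r‖ ^ 2 - (t - r)| ≤ C * √(t - r) * (t - r) := by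
  obtain ⟨M, hM⟩ := (isCompact_Icc (a := (0 : ℝ)) (b := c)).exists_bound_of_continuousOn
    ((continuousOn_pert_kerVec K).mono fun x hx ↦ ⟨hx.1, hx.2.trans_lt hc⟩)
  obtain ⟨A, hA⟩ := (isCompact_Icc (a := (0 : ℝ)) (b := 1)).exists_bound_of_continuousOn
    h.continuous.continuousOn
  obtain ⟨B, hB⟩ := (isCompact_Icc (a := (0 : ℝ)) (b := 1)).exists_bound_of_continuousOn
    g.continuous.continuousOn
  refine ⟨2 * A * B + A ^ 2 + 2 * (‖pert h g‖ * M) + M ^ 2, fun r t hr hrt htc ↦ ?_⟩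
  have hr' : r ∈ Ico (0 : ℝ) 1 := ⟨hr, by linarith⟩
  have ht' : t ∈ Ico (0 : ℝ) 1 := ⟨by linarith, by linarith⟩
  have hr'' : r ∈ Icc (0 : ℝ) 1 := ⟨hr'.1, hr'.2.le⟩
  have ht'' : t ∈ Icc (0 : ℝ) 1 := ⟨ht'.1, ht'.2.le⟩
  have hA0 : 0 ≤ A := (norm_nonneg _).trans (hA 0 (by simp))
  have hB0 : 0 ≤ B := (norm_nonneg _).trans (hB 0 (by simp))
  have hM0 : 0 ≤ M := (norm_nonneg _).trans (hM r ⟨hr, by linarith⟩)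
  set d := t - r with hd
  have hd0 : 0 ≤ d := sub_nonneg.2 hrt
  set x := cut 1 t - cut 1 r with hx
  set y := ∫ q in r..t, pert h g (kerVec h g a b q) with hy
  have hxn : ‖x‖ ^ 2 = d := by
    rw [hx, norm_cut_sub_sq 1 hr hrt ht''.2]; simp [hd]
  have hxn' : ‖x‖ = √d := by rw [← hxn, Real.sqrt_sq (norm_nonneg _)]
  have hinc : ∀ (e : C(ℝ, ℝ)) (D : ℝ), (∀ q ∈ Icc (0 : ℝ) 1, ‖e q‖ ≤ D) →
      |⟪cut e 1, x⟫| ≤ D * d := fun e D hD ↦ by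
    have hint : ∀ x y : ℝ, IntervalIntegrable e volume x y := e.continuous.intervalIntegrable
    have : ⟪cut e 1, x⟫ = ∫ q in r..t, e q := by
      rw [hx, inner_sub_right, inner_cut_one_left _ _ ht'', inner_cut_one_left _ _ hr'']
      simp [intervalIntegral.integral_interval_sub_left (hint 0 t) (hint 0 r)]
    rw [this, ← abs_of_nonneg hd0, ← Real.norm_eq_abs]
    refine intervalIntegral.norm_integral_le_of_norm_le_const fun q hq ↦ ?_
    rw [uIoc_of_le hrt] at hq
    exact hD q ⟨hr.trans hq.1.le, hq.2.trans ht''.2⟩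
  have hyn : ‖y‖ ≤ M * d := by
    rw [hy, ← abs_of_nonneg hd0]
    refine intervalIntegral.norm_integral_le_of_norm_le_const fun q hq ↦ ?_
    rw [uIoc_of_le hrt] at hq
    exact hM q ⟨hr.trans hq.1.le, hq.2.trans htc⟩
  have hxy : |⟪pert h g x, y⟫| ≤ ‖pert h g‖ * √d * (M * d) := by
    refine (abs_real_inner_le_norm _ _).trans ?_
    have := (pert h g).le_opNorm x
    rw [hxn'] at this
    gcongr
  have hd1 : d ≤ 1 := by linarith [hr, ht''.2]
  have hds : d ≤ √d := by
    apply Real.le_sqrt_of_sq_le; nlinarith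
  have h1 := hinc h A hA
  have h2 := hinc g B hB
  have e12 : |⟪cut h 1, x⟫ * ⟪cut g 1, x⟫| ≤ A * B * (d * d) := by
    rw [abs_mul]
    calc _ ≤ (A * d) * (B * d) := by gcongr
      _ = _ := by ring
  have e11 : |⟪cut h 1, x⟫ * ⟪cut h 1, x⟫| ≤ A * A * (d * d) := by
    rw [abs_mul]
    calc _ ≤ (A * d) * (A * d) := by gcongr
      _ = _ := by ring
  have eyy : ‖y‖ ^ 2 ≤ M ^ 2 * (d * d) := by
    calc _ ≤ (M * d) ^ 2 := by gcongr
      _ = _ := by ring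
  have hdd : d * d ≤ √d * d := by gcongr
  rw [innovVec_sub K hr' ht', ← hx, ← hy, norm_add_sq_real, ← real_inner_self_eq_norm_sq (pert h g x),
    inner_pert K.norm, real_inner_self_eq_norm_sq x, hxn]
  have p1 : A * B * (d * d) ≤ A * B * (√d * d) := by gcongr
  have p2 : A * A * (d * d) ≤ A * A * (√d * d) := by gcongr
  have p3 : M ^ 2 * (d * d) ≤ M ^ 2 * (√d * d) := by gcongr
  rw [abs_le] at *
  constructor <;> nlinarith [sq_nonneg ‖y‖]

/-- The transformed process has variance `t` at time `t`: the variance minus `t` has right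
derivative zero, since the increments are orthogonal. -/
lemma norm_innovVec_sq (K : KernelSystem h g a b) {t : ℝ} (ht0 : 0 ≤ t) (ht : t < 1) :
    ‖innovVec h g a b t‖ ^ 2 = t := by
  obtain ⟨C, hC⟩ := exists_norm_innovVec_sub_sq_le K ht
  have key : ∀ r s, 0 ≤ r → r ≤ s → s ≤ t →
      |(‖innovVec h g a b s‖ ^ 2 - s) - (‖innovVec h g a b r‖ ^ 2 - r)|
        ≤ C * √(s - r) * (s - r) := fun r s hr hrs hst ↦ by
    have := hC r s hr hrs hst
    rw [← norm_innovVec_sq_sub K hr hrs (hst.trans_lt ht)] at this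
    convert this using 2
    ring
  set f : ℝ → ℝ := fun s ↦ ‖innovVec h g a b s‖ ^ 2 - s with hf
  have key' : ∀ x ∈ Icc 0 t, ∀ s ∈ Icc 0 t, |f s - f x| ≤ C * √|s - x| * |s - x| := by
    intro x hx s hs
    rcases le_total x s with hxs | hxs
    · rw [abs_of_nonneg (sub_nonneg.2 hxs)]; exact key x s hx.1 hxs hs.2
    · rw [abs_sub_comm, abs_sub_comm s x, abs_of_nonneg (sub_nonneg.2 hxs)]
      exact key s x hs.1 hxs hx.2
  have hlim : ∀ x : ℝ, Tendsto (fun s ↦ C * √|s - x|) (𝓝 x) (𝓝 0) := fun x ↦ by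
    have : Continuous (fun s ↦ C * √|s - x|) := by fun_prop
    simpa using this.tendsto x
  have hder : ∀ x ∈ Icc 0 t, HasDerivWithinAt f 0 (Icc 0 t) x := by
    intro x hx
    rw [hasDerivWithinAt_iff_isLittleO, Asymptotics.isLittleO_iff]
    intro ε hε
    filter_upwards [self_mem_nhdsWithin,
      nhdsWithin_le_nhds ((hlim x).eventually (gt_mem_nhds hε))] with s hs hsε
    rw [smul_zero, sub_zero, Real.norm_eq_abs, Real.norm_eq_abs]
    exact (key' x hx s hs).trans (by gcongr)
  have hconst := constant_of_has_deriv_right_zero (f := f) (a := 0) (b := t)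
    (fun x hx ↦ (hder x hx).continuousWithinAt) (fun x hx ↦
      ((hder x ⟨hx.1, hx.2.le⟩).mono_of_mem_nhdsWithin (by
        filter_upwards [self_mem_nhdsWithin, nhdsWithin_le_nhds (Iio_mem_nhds hx.2)] with y h1 h2
        exact ⟨hx.1.trans h1, le_of_lt h2⟩))) t ⟨ht0, le_rfl⟩
  have hzero : innovVec h g a b 0 = 0 := by simp [innovVec, cut_zero_right]
  simp only [hf, hzero, norm_zero] at hconst
  linarith

lemma inner_innovVec (K : KernelSystem h g a b) {s t : ℝ} (hs : s ∈ Ico (0 : ℝ) 1)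
    (ht : t ∈ Ico (0 : ℝ) 1) : ⟪innovVec h g a b s, innovVec h g a b t⟫ = min s t := by
  wlog hst : s ≤ t generalizing s t
  · rw [real_inner_comm, this ht hs (by linarith), min_comm]
  have := inner_innovVec_innovVec_sub K hs.1 hst ht.2
  rw [inner_sub_right, sub_eq_zero, real_inner_self_eq_norm_sq, norm_innovVec_sq K hs.1 hs.2] at this
  rw [this, min_eq_left hst]

end

/-- A curve in a Hilbert space over `[0, 1)` with the covariance of the Wiener process extends
to `[0, 1]`. -/
lemma exists_inner_eq_min {E : Type*} [NormedAddCommGroup E] [InnerProductSpace ℝ E]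
    [CompleteSpace E] {v : ℝ → E}
    (hv : ∀ s ∈ Ico (0 : ℝ) 1, ∀ t ∈ Ico (0 : ℝ) 1, ⟪v s, v t⟫ = min s t) :
    ∃ v' : ℝ → E, (∀ t, t ≠ 1 → v' t = v t) ∧ Tendsto v (𝓝[<] 1) (𝓝 (v' 1)) ∧
      ∀ s ∈ Icc (0 : ℝ) 1, ∀ t ∈ Icc (0 : ℝ) 1, ⟪v' s, v' t⟫ = min s t := by
  have hn : ∀ s ∈ Ico (0 : ℝ) 1, ∀ t ∈ Ico (0 : ℝ) 1, ‖v s - v t‖ ^ 2 = |s - t| := by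
    intro s hs t ht
    rw [norm_sub_sq_real, ← real_inner_self_eq_norm_sq, ← real_inner_self_eq_norm_sq, hv s hs s hs,
      hv t ht t ht, hv s hs t ht, min_self, min_self]
    rcases le_total s t with h | h
    · rw [min_eq_left h, abs_of_nonpos (by linarith)]; ring
    · rw [min_eq_right h, abs_of_nonneg (by linarith)]; ring
  have hmem : ∀ᶠ t in 𝓝[<] (1 : ℝ), t ∈ Ico (0 : ℝ) 1 := by
    filter_upwards [self_mem_nhdsWithin, mem_nhdsWithin_of_mem_nhds (Ioi_mem_nhds zero_lt_one)]
      with t h1 h2 using ⟨le_of_lt h2, h1⟩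
  have hcauchy : Cauchy (map v (𝓝[<] (1 : ℝ))) := by
    rw [Metric.cauchy_iff]
    refine ⟨inferInstance, fun ε hε ↦ ?_⟩
    have hnear : ∀ᶠ t in 𝓝[<] (1 : ℝ), 1 - ε ^ 2 < t :=
      mem_nhdsWithin_of_mem_nhds (Ioi_mem_nhds (by have := pow_pos hε 2; linarith))
    refine ⟨v '' {t | t ∈ Ico (0 : ℝ) 1 ∧ 1 - ε ^ 2 < t}, image_mem_map (hmem.and hnear), ?_⟩
    rintro _ ⟨s, ⟨hs, hs'⟩, rfl⟩ _ ⟨t, ⟨ht, ht'⟩, rfl⟩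
    rw [dist_eq_norm]
    refine lt_of_pow_lt_pow_left₀ 2 hε.le ?_
    rw [hn s hs t ht, abs_lt]
    constructor <;> linarith [hs.2, ht.2]
  obtain ⟨l, hl⟩ := CompleteSpace.complete hcauchy
  have hl : Tendsto v (𝓝[<] 1) (𝓝 l) := hl
  refine ⟨Function.update v 1 l, fun t ht ↦ by simp [ht], by simpa using hl, ?_⟩
  have hl1 : ∀ s ∈ Ico (0 : ℝ) 1, ⟪v s, l⟫ = s := fun s hs ↦ by
    refine tendsto_nhds_unique ((tendsto_const_nhds (x := v s)).inner hl) ?_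
    refine tendsto_const_nhds.congr' ?_
    filter_upwards [hmem, mem_nhdsWithin_of_mem_nhds (Ioi_mem_nhds hs.2)] with t ht hst
    rw [hv s hs t ht, min_eq_left (le_of_lt hst)]
  have hl2 : ⟪l, l⟫ = (1 : ℝ) := by
    refine tendsto_nhds_unique (hl.inner (tendsto_const_nhds (x := l))) ?_
    refine Tendsto.congr' (f₁ := fun t ↦ t) ?_ (tendsto_id.mono_left nhdsWithin_le_nhds)
    filter_upwards [hmem] with t ht using (hl1 t ht).symm
  intro s hs t ht
  rcases hs.2.eq_or_lt with rfl | hs1 <;> rcases ht.2.eq_or_lt with rfl | ht1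
  · simpa using hl2
  · rw [Function.update_self, Function.update_of_ne ht1.ne, real_inner_comm, hl1 t ⟨ht.1, ht1⟩,
      min_eq_right ht.2]
  · rw [Function.update_self, Function.update_of_ne hs1.ne, hl1 s ⟨hs.1, hs1⟩,
      min_eq_left hs.2]
  · rw [Function.update_of_ne hs1.ne, Function.update_of_ne ht1.ne, hv s ⟨hs.1, hs1⟩ t ⟨ht.1, ht1⟩]


/-! ### Isometries from Gram matrices -/

/-- Two families with the same Gram matrix, the first of them total, are related by a linear
isometry. -/
lemma exists_linearIsometry_of_gram {ι E F : Type*} [NormedAddCommGroup E] [InnerProductSpace ℝ E]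
    [CompleteSpace E] [NormedAddCommGroup F] [InnerProductSpace ℝ F] [CompleteSpace F]
    (e : ι → F) (x : ι → E) (hgram : ∀ i j, ⟪x i, x j⟫ = ⟪e i, e j⟫)
    (he : ∀ φ : F, (∀ i, ⟪e i, φ⟫ = 0) → φ = 0) :
    DenseRange (Finsupp.linearCombination ℝ e) ∧ ∃ J : F →ₗᵢ[ℝ] E, ∀ i, J (e i) = x i := by
  have hnorm : ∀ c, ‖Finsupp.linearCombination ℝ x c‖ = ‖Finsupp.linearCombination ℝ e c‖ := by
    intro c
    rw [← sq_eq_sq₀ (norm_nonneg _) (norm_nonneg _), ← real_inner_self_eq_norm_sq,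
      ← real_inner_self_eq_norm_sq]
    simp only [Finsupp.linearCombination_apply, Finsupp.sum, sum_inner, inner_sum,
      inner_smul_left, inner_smul_right, hgram]
  have hd : DenseRange (Finsupp.linearCombination ℝ e) := by
    have h1 : (LinearMap.range (Finsupp.linearCombination ℝ e)).topologicalClosure = ⊤ := by
      rw [Submodule.topologicalClosure_eq_top_iff, Submodule.eq_bot_iff]
      intro φ hφ
      refine he φ fun i ↦ ?_
      refine (Submodule.mem_orthogonal _ _).1 hφ _ ⟨Finsupp.single i 1, ?_⟩
      simp
    have := (Submodule.dense_iff_topologicalClosure_eq_top).2 h1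
    rwa [LinearMap.coe_range] at this
  let L := (Finsupp.linearCombination ℝ x).extendOfNorm (Finsupp.linearCombination ℝ e)
  have hL : ∀ c, L (Finsupp.linearCombination ℝ e c) = Finsupp.linearCombination ℝ x c :=
    LinearMap.extendOfNorm_eq hd ⟨1, fun c ↦ by rw [hnorm, one_mul]⟩
  have hLn : ∀ φ, ‖L φ‖ = ‖φ‖ := fun φ ↦ by
    refine hd.induction_on (p := fun φ ↦ ‖L φ‖ = ‖φ‖) φ (isClosed_eq (by fun_prop) (by fun_prop))
      fun c ↦ ?_
    rw [hL, hnorm]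
  refine ⟨hd, ⟨L.toLinearMap, hLn⟩, fun i ↦ ?_⟩
  have := hL (Finsupp.single i 1)
  simpa using this

variable {Ω : Type*} [MeasurableSpace Ω] {P : Measure Ω}

/-! ### Gaussian laws through characteristic functions -/

lemma hasLaw_gaussianReal_iff [IsProbabilityMeasure P] {X : Ω → ℝ} (hX : AEMeasurable X P)
    (v : ℝ≥0) : HasLaw X (gaussianReal 0 v) P ↔
      ∀ u : ℝ, ∫ ω, Complex.exp (u * X ω * Complex.I) ∂P = Complex.exp (-(v * u ^ 2 / 2)) := by
  have h1 : ∀ u, charFun (P.map X) u = ∫ ω, Complex.exp (u * X ω * Complex.I) ∂P := fun u ↦ by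
    rw [charFun_apply_real, integral_map hX (by fun_prop)]
  constructor
  · intro h u
    rw [← h1, h.map_eq, charFun_gaussianReal]
    congr 1
    simp
  · intro h
    have : IsProbabilityMeasure (P.map X) := Measure.isProbabilityMeasure_map hX
    refine ⟨hX, Measure.ext_of_charFun (funext fun u ↦ ?_)⟩
    rw [h1, h, charFun_gaussianReal]
    congr 1
    simp

lemma norm_exp_mul_I_sub_le (x y : ℝ) :
    ‖Complex.exp (x * Complex.I) - Complex.exp (y * Complex.I)‖ ≤ |x - y| := by
  have : Complex.exp (x * Complex.I) - Complex.exp (y * Complex.I) =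
      Complex.exp (y * Complex.I) * (Complex.exp (Complex.I * ((x - y : ℝ) : ℂ)) - 1) := by
    rw [mul_sub, ← Complex.exp_add]
    push_cast
    ring_nf
  rw [this, norm_mul, Complex.norm_exp_ofReal_mul_I, one_mul]
  exact Real.norm_exp_I_mul_ofReal_sub_one_le

lemma continuous_integral_exp [IsProbabilityMeasure P] (u : ℝ) :
    Continuous fun ψ : Lp ℝ 2 P ↦ ∫ ω, Complex.exp (u * ψ ω * Complex.I) ∂P := by
  have hint : ∀ ψ : Lp ℝ 2 P, Integrable (fun ω ↦ Complex.exp (u * ψ ω * Complex.I)) P := by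
    intro ψ
    refine Integrable.of_bound (C := 1) ?_ (Eventually.of_forall fun ω ↦ ?_)
    · have := Lp.aestronglyMeasurable ψ
      fun_prop
    · rw [← Complex.ofReal_mul, Complex.norm_exp_ofReal_mul_I]
  refine (LipschitzWith.of_dist_le_mul (K := ‖u‖₊) fun ψ χ ↦ ?_).continuous
  have h2 : MemLp (ψ - χ : Lp ℝ 2 P) 2 P := Lp.memLp _
  have h1 : Integrable (ψ - χ : Lp ℝ 2 P) P := h2.integrable (by norm_num)
  rw [dist_eq_norm, ← integral_sub (hint ψ) (hint χ), dist_eq_norm]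
  calc _ ≤ ∫ ω, |u| * ‖(ψ - χ : Lp ℝ 2 P) ω‖ ∂P := by
        refine norm_integral_le_of_norm_le (h1.norm.const_mul _) ?_
        filter_upwards [Lp.coeFn_sub ψ χ] with ω hω
        rw [hω, Pi.sub_apply, ← Complex.ofReal_mul, ← Complex.ofReal_mul, Real.norm_eq_abs,
          ← abs_mul, mul_sub]
        exact norm_exp_mul_I_sub_le _ _
    _ = |u| * ∫ ω, ‖(ψ - χ : Lp ℝ 2 P) ω‖ ∂P := integral_const_mul _ _
    _ ≤ |u| * ‖ψ - χ‖ := by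
        gcongr
        rw [integral_norm_eq_lintegral_enorm h1.aestronglyMeasurable, Lp.norm_def,
          ← eLpNorm_one_eq_lintegral_enorm]
        exact ENNReal.toReal_mono h2.eLpNorm_ne_top
          (eLpNorm_le_eLpNorm_of_exponent_le (by norm_num) h1.aestronglyMeasurable)
    _ = _ := by simp

/-! ### The Wiener integral -/

/-- `J` is the Wiener integral of `W`: the linear isometry `L²(0, 1) → L²(P)` which maps
`1_(0, t]` to `W t`. -/
structure IsWienerIntegral (W : ℝ → Ω → ℝ) (P : Measure Ω) (J : L2I →ₗᵢ[ℝ] Lp ℝ 2 P) : Prop where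
  cut_one : ∀ t ∈ Icc (0 : ℝ) 1, J (cut 1 t) =ᵐ[P] W t
  hasLaw : ∀ φ, HasLaw (J φ) (gaussianReal 0 (‖φ‖₊ ^ 2)) P

lemma IsWienerProcess.hasLaw_eval {W : ℝ → Ω → ℝ} (hW : IsWienerProcess W P) {t : ℝ}
    (ht : t ∈ Icc (0 : ℝ) 1) : HasLaw (W t) (gaussianReal 0 t.toNNReal) P := by
  have := hW.law 0 t le_rfl ht.1 ht.2
  rw [sub_zero] at this
  refine this.congr ?_
  filter_upwards [hW.zero] with ω hω
  rw [hω, sub_zero]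

lemma IsWienerProcess.integral_mul {W : ℝ → Ω → ℝ} (hW : IsWienerProcess W P) {s t : ℝ}
    (hs : s ∈ Icc (0 : ℝ) 1) (ht : t ∈ Icc (0 : ℝ) 1) : ∫ ω, W s ω * W t ω ∂P = min s t := by
  wlog hst : s ≤ t generalizing s t
  · simp_rw [mul_comm (W s _), this ht hs (by linarith), min_comm]
  have hP : IsProbabilityMeasure P := (hW.hasLaw_eval hs).isProbabilityMeasure
  have hind : IndepFun (W s) (W t - W s) P :=
    hW.indep.indepFun_eval_sub (r := ⟨0, by simp⟩) (s := ⟨s, hs⟩) (t := ⟨t, ht⟩)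
      hs.1 hst hW.zero
  have ms : MemLp (W s) 2 P := (hW.hasLaw_eval hs).hasGaussianLaw.memLp_two
  have mt : MemLp (W t) 2 P := (hW.hasLaw_eval ht).hasGaussianLaw.memLp_two
  have zs : ∫ ω, W s ω ∂P = 0 := by
    rw [(hW.hasLaw_eval hs).integral_eq, integral_id_gaussianReal]
  have e1 : ∫ ω, W s ω * (W t - W s) ω ∂P = 0 := by
    rw [hind.integral_fun_mul_eq_mul_integral ms.aestronglyMeasurable
      (mt.sub ms).aestronglyMeasurable, zs, zero_mul]
  have e2 : ∫ ω, W s ω * W s ω ∂P = s := by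
    have h := (hW.hasLaw_eval hs).variance_eq
    rw [variance_id_gaussianReal, variance_of_integral_eq_zero ms.aemeasurable zs] at h
    simpa [sq, hs.1] using h
  calc ∫ ω, W s ω * W t ω ∂P = ∫ ω, (W s ω * (W t - W s) ω + W s ω * W s ω) ∂P := by
        congr with ω; simp; ring
    _ = s := by
        have := integral_add (ms.integrable_mul (mt.sub ms)) (ms.integrable_mul ms)
        simp only [Pi.mul_apply] at this
        rw [this, e1, e2, zero_add]
    _ = min s t := (min_eq_left hst).symm

/-- The Wiener integral exists. Its values are Gaussian because the finite linear combinations of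
the `W t` are, and because Gaussian laws are preserved by limits in `L²`. -/
lemma IsWienerProcess.exists_isWienerIntegral [IsProbabilityMeasure P] {W : ℝ → Ω → ℝ}
    (hW : IsWienerProcess W P) : ∃ J : L2I →ₗᵢ[ℝ] Lp ℝ 2 P, IsWienerIntegral W P J := by
  have hm : ∀ t : Icc (0 : ℝ) 1, MemLp (W t) 2 P := fun t ↦
    (hW.hasLaw_eval t.2).hasGaussianLaw.memLp_two
  obtain ⟨hd, J, hJ⟩ := exists_linearIsometry_of_gram (fun t : Icc (0 : ℝ) 1 ↦ cut 1 t)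
    (fun t : Icc (0 : ℝ) 1 ↦ (hm t).toLp _) (fun s t ↦ by
      rw [inner_cut_one s.2 t.2, ← hW.integral_mul s.2 t.2, L2.inner_def (𝕜 := ℝ)]
      refine integral_congr_ae ?_
      filter_upwards [(hm s).coeFn_toLp, (hm t).coeFn_toLp] with ω h1 h2
      rw [h1, h2, mul_comm]; rfl) (fun φ hφ ↦ eq_zero_of_inner_cut_one fun t ht ↦ hφ ⟨t, ht⟩)
  have hJ' : ∀ t : Icc (0 : ℝ) 1, J (cut 1 t) =ᵐ[P] W t := fun t ↦ by
    rw [hJ]; exact (hm t).coeFn_toLp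
  refine ⟨J, fun t ht ↦ hJ' ⟨t, ht⟩, fun φ ↦ ?_⟩
  rw [hasLaw_gaussianReal_iff (Lp.aestronglyMeasurable _).aemeasurable]
  intro u
  refine hd.induction_on (p := fun φ ↦ ∫ ω, Complex.exp (u * J φ ω * Complex.I) ∂P =
    Complex.exp (-((‖φ‖₊ ^ 2 : ℝ≥0) * u ^ 2 / 2))) φ
    (isClosed_eq ((continuous_integral_exp u).comp J.continuous) ?_) fun c ↦ ?_
  · simp only [NNReal.coe_pow, coe_nnnorm]
    fun_prop
  have hG : IsGaussianProcess (fun t : Icc (0 : ℝ) 1 ↦ W t) P :=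
    hW.indep.isGaussianProcess (fun t ↦ (hW.hasLaw_eval t.2).hasGaussianLaw) hW.zero
  set ψ := Finsupp.linearCombination ℝ (fun t : Icc (0 : ℝ) 1 ↦ cut 1 t) c with hψ
  -- the linear functional that forms the linear combination with coefficients `c`
  let L : (c.support → ℝ) →L[ℝ] ℝ := ∑ t : c.support, c t • ContinuousLinearMap.proj t
  have hsum : ∀ s : Finset (Icc (0 : ℝ) 1), (J (∑ t ∈ s, c t • cut 1 t) : Lp ℝ 2 P) =ᵐ[P]
      fun ω ↦ ∑ t ∈ s, c t * W t ω := by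
    intro s
    classical
    induction s using Finset.induction_on with
    | empty => simpa using! Lp.coeFn_zero ℝ 2 P
    | insert t s hts ih =>
      rw [Finset.sum_insert hts, map_add, map_smul]
      filter_upwards [ih, hJ' t, Lp.coeFn_add (c t • J (cut 1 t)) (J (∑ t ∈ s, c t • cut 1 t)),
        Lp.coeFn_smul (c t) (J (cut 1 t))] with ω h1 h2 h3 h4
      rw [h3, Pi.add_apply, h1, h4, Pi.smul_apply, h2, Finset.sum_insert hts, smul_eq_mul]
  have hψJ : J ψ =ᵐ[P] fun ω ↦ ∑ t ∈ c.support, c t * W t ω := hsum c.support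
  have hgl : HasGaussianLaw (J ψ) P := by
    refine ((hG.hasGaussianLaw c.support).map L).congr ?_
    filter_upwards [hψJ] with ω hω
    rw [hω, ← Finset.sum_coe_sort]
    simp [L]
  have hmean : ∫ ω, J ψ ω ∂P = 0 := by
    rw [integral_congr_ae hψJ, integral_finsetSum _ fun t _ ↦
      ((hm t).integrable (by norm_num)).const_mul _]
    refine Finset.sum_eq_zero fun t _ ↦ ?_
    rw [integral_const_mul, (hW.hasLaw_eval t.2).integral_eq, integral_id_gaussianReal, mul_zero]
  have hvar : Var[J ψ; P] = ‖ψ‖ ^ 2 := by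
    rw [variance_of_integral_eq_zero (Lp.aestronglyMeasurable _).aemeasurable hmean,
      ← J.norm_map ψ, ← real_inner_self_eq_norm_sq, L2.inner_def (𝕜 := ℝ)]
    simp [sq]
  have hlaw : HasLaw (J ψ) (gaussianReal 0 (‖ψ‖₊ ^ 2)) P := by
    refine ⟨hgl.aemeasurable, ?_⟩
    rw [hgl.map_eq_gaussianReal, hmean, hvar]
    congr 1
    ext; simp
  exact (hasLaw_gaussianReal_iff hgl.aemeasurable _).1 hlaw u

/-- The joint law of a family of Wiener integrals is determined by its Gram matrix. -/
lemma IsWienerIntegral.map_eq_of_gram [IsProbabilityMeasure P] {W : ℝ → Ω → ℝ}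
    {J : L2I →ₗᵢ[ℝ] Lp ℝ 2 P} (hJ : IsWienerIntegral W P J) {ι : Type*} [Fintype ι] {φ ψ : ι → L2I}
    (hgram : ∀ i j, ⟪φ i, φ j⟫ = ⟪ψ i, ψ j⟫) {X Y : ι → Ω → ℝ} (hX : ∀ i, X i =ᵐ[P] J (φ i))
    (hY : ∀ i, Y i =ᵐ[P] J (ψ i)) :
    P.map (fun ω i ↦ X i ω) = P.map (fun ω i ↦ Y i ω) := by
  classical
  have hmeas : ∀ {X : ι → Ω → ℝ} {φ : ι → L2I}, (∀ i, X i =ᵐ[P] J (φ i)) →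
      AEMeasurable (fun ω i ↦ X i ω) P := fun {X φ} hX ↦
    aemeasurable_pi_lambda _ fun i ↦
      (Lp.aestronglyMeasurable (J (φ i))).aemeasurable.congr (hX i).symm
  have hchar : ∀ {X : ι → Ω → ℝ} {φ : ι → L2I}, (∀ i, X i =ᵐ[P] J (φ i)) →
      ∀ L : StrongDual ℝ (ι → ℝ), charFunDual (P.map (fun ω i ↦ X i ω)) L =
        Complex.exp (-(‖∑ i, L (Pi.single i 1) • φ i‖ ^ 2 / 2)) := by
    intro X φ hX L
    rw [charFunDual_apply, integral_map (hmeas hX) (by fun_prop)]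
    have h1 := (hasLaw_gaussianReal_iff (Lp.aestronglyMeasurable _).aemeasurable _).1
      (hJ.hasLaw (∑ i, L (Pi.single i 1) • φ i)) 1
    have hsum : ∀ s : Finset ι, (J (∑ i ∈ s, L (Pi.single i 1) • φ i) : Lp ℝ 2 P) =ᵐ[P]
        fun ω ↦ ∑ i ∈ s, L (Pi.single i 1) * X i ω := by
      intro s
      induction s using Finset.induction_on with
      | empty => simpa using! Lp.coeFn_zero ℝ 2 P
      | insert i s his ih =>
        rw [Finset.sum_insert his, map_add, map_smul]
        filter_upwards [ih, hX i, Lp.coeFn_add (L (Pi.single i 1) • J (φ i))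
          (J (∑ i ∈ s, L (Pi.single i 1) • φ i)), Lp.coeFn_smul (L (Pi.single i 1)) (J (φ i))]
          with ω h1 h2 h3 h4
        rw [h3, Pi.add_apply, h1, h4, Pi.smul_apply, ← h2, Finset.sum_insert his, smul_eq_mul]
    trans Complex.exp (-((‖∑ i, L (Pi.single i 1) • φ i‖₊ ^ 2 : ℝ≥0) * (1 : ℝ) ^ 2 / 2))
    · rw [← h1]
      refine integral_congr_ae ?_
      filter_upwards [hsum Finset.univ] with ω hω
      rw [hω]
      congr 2
      have : (fun i ↦ X i ω) = ∑ i, X i ω • Pi.single i (1 : ℝ) := by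
        ext j; simp [Finset.sum_apply, Pi.single_apply]
      rw [this, map_sum]
      simp [mul_comm]
    · simp
  have : IsProbabilityMeasure (P.map (fun ω i ↦ X i ω)) := Measure.isProbabilityMeasure_map (hmeas hX)
  have : IsProbabilityMeasure (P.map (fun ω i ↦ Y i ω)) := Measure.isProbabilityMeasure_map (hmeas hY)
  refine Measure.ext_of_charFunDual (funext fun L ↦ ?_)
  have hnorm : ‖∑ i, L (Pi.single i 1) • φ i‖ = ‖∑ i, L (Pi.single i 1) • ψ i‖ := by
    rw [← sq_eq_sq₀ (norm_nonneg _) (norm_nonneg _), ← real_inner_self_eq_norm_sq,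
      ← real_inner_self_eq_norm_sq]
    simp only [sum_inner, inner_sum, inner_smul_left, inner_smul_right, hgram]
  rw [hchar hX, hchar hY, hnorm]

lemma norm_sub_sq_of_inner_eq_min {E : Type*} [NormedAddCommGroup E] [InnerProductSpace ℝ E]
    {v : ℝ → E} (hv : ∀ s ∈ Icc (0 : ℝ) 1, ∀ t ∈ Icc (0 : ℝ) 1, ⟪v s, v t⟫ = min s t) {s t : ℝ}
    (hs : 0 ≤ s) (hst : s ≤ t) (ht : t ≤ 1) : ‖v t - v s‖ ^ 2 = t - s := by
  have hs' : s ∈ Icc (0 : ℝ) 1 := ⟨hs, hst.trans ht⟩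
  have ht' : t ∈ Icc (0 : ℝ) 1 := ⟨hs.trans hst, ht⟩
  rw [norm_sub_sq_real, ← real_inner_self_eq_norm_sq, ← real_inner_self_eq_norm_sq,
    hv t ht' t ht', hv s hs' s hs', hv t ht' s hs', min_self, min_self, min_eq_right hst]
  ring

/-- A process with continuous paths whose values are Wiener integrals and whose covariance is
`min s t` is a Wiener process. -/
lemma IsWienerIntegral.isWienerProcess [IsProbabilityMeasure P] {W : ℝ → Ω → ℝ}
    (hW : IsWienerProcess W P)
    {J : L2I →ₗᵢ[ℝ] Lp ℝ 2 P} (hJ : IsWienerIntegral W P J) {v : ℝ → L2I}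
    (hv : ∀ s ∈ Icc (0 : ℝ) 1, ∀ t ∈ Icc (0 : ℝ) 1, ⟪v s, v t⟫ = min s t) {w : ℝ → Ω → ℝ}
    (hw : ∀ t ∈ Icc (0 : ℝ) 1, w t =ᵐ[P] J (v t))
    (hc : ∀ᵐ ω ∂P, ContinuousOn (fun t ↦ w t ω) (Icc 0 1)) : IsWienerProcess w P := by
  have hsub : ∀ s ∈ Icc (0 : ℝ) 1, ∀ t ∈ Icc (0 : ℝ) 1,
      (fun ω ↦ w t ω - w s ω) =ᵐ[P] J (v t - v s) := by
    intro s hs t ht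
    rw [map_sub]
    filter_upwards [hw s hs, hw t ht, Lp.coeFn_sub (J (v t)) (J (v s))] with ω h1 h2 h3
    rw [h3, Pi.sub_apply, h1, h2]
  have hsubW : ∀ s ∈ Icc (0 : ℝ) 1, ∀ t ∈ Icc (0 : ℝ) 1,
      (fun ω ↦ W t ω - W s ω) =ᵐ[P] J (cut 1 t - cut 1 s) := by
    intro s hs t ht
    rw [map_sub]
    filter_upwards [hJ.cut_one s hs, hJ.cut_one t ht, Lp.coeFn_sub (J (cut 1 t)) (J (cut 1 s))]
      with ω h1 h2 h3
    rw [h3, Pi.sub_apply, h1, h2]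
  refine ⟨?_, fun n t ht ↦ ?_, fun s t hs hst ht ↦ ?_, hc⟩
  · have h0 : v 0 = 0 := by
      have := hv 0 (by simp) 0 (by simp)
      simpa using this
    filter_upwards [hw 0 (by simp), Lp.coeFn_zero ℝ 2 P] with ω h1 h2
    rw [h1, h0, map_zero, h2]; rfl
  · have hmw : ∀ i : Fin n, AEMeasurable (fun ω ↦ w (t i.succ) ω - w (t i.castSucc) ω) P :=
      fun i ↦ (Lp.aestronglyMeasurable _).aemeasurable.congr
        (hsub _ (t i.castSucc).2 _ (t i.succ).2).symm
    have hmW : ∀ i : Fin n, AEMeasurable (fun ω ↦ W (t i.succ) ω - W (t i.castSucc) ω) P :=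
      fun i ↦ (Lp.aestronglyMeasurable _).aemeasurable.congr
        (hsubW _ (t i.castSucc).2 _ (t i.succ).2).symm
    have hmap : P.map (fun ω (i : Fin n) ↦ w (t i.succ) ω - w (t i.castSucc) ω) =
        P.map (fun ω (i : Fin n) ↦ W (t i.succ) ω - W (t i.castSucc) ω) := by
      refine hJ.map_eq_of_gram (fun i j ↦ ?_) (fun i ↦ hsub _ (t i.castSucc).2 _ (t i.succ).2)
        (fun i ↦ hsubW _ (t i.castSucc).2 _ (t i.succ).2)
      simp only [inner_sub_left, inner_sub_right]
      simp only [inner_cut_one (t _).2 (t _).2, hv _ (t _).2 _ (t _).2]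
    rw [iIndepFun_iff_map_fun_eq_pi_map hmw, hmap,
      (iIndepFun_iff_map_fun_eq_pi_map hmW).1 (hW.indep n t ht)]
    congr with i : 1
    have : (P.map (fun ω (i : Fin n) ↦ w (t i.succ) ω - w (t i.castSucc) ω)).map (fun x ↦ x i) =
        (P.map (fun ω (i : Fin n) ↦ W (t i.succ) ω - W (t i.castSucc) ω)).map (fun x ↦ x i) := by
      rw [hmap]
    rw [AEMeasurable.map_map_of_aemeasurable (measurable_pi_apply i).aemeasurable
        (aemeasurable_pi_lambda _ hmw),
      AEMeasurable.map_map_of_aemeasurable (measurable_pi_apply i).aemeasurable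
        (aemeasurable_pi_lambda _ hmW)] at this
    exact this.symm
  · have hs' : s ∈ Icc (0 : ℝ) 1 := ⟨hs, hst.trans ht⟩
    have ht' : t ∈ Icc (0 : ℝ) 1 := ⟨hs.trans hst, ht⟩
    have h1 := hJ.hasLaw (v t - v s)
    have h2 : ‖v t - v s‖₊ ^ 2 = (t - s).toNNReal := by
      ext
      rw [NNReal.coe_pow, coe_nnnorm, norm_sub_sq_of_inner_eq_min hv hs hst ht,
        Real.coe_toNNReal _ (by linarith)]
    rw [h2] at h1
    exact h1.congr (hsub s hs' t ht')


/-! ### Stochastic integrals as limits in `L²(P)` -/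

lemma coeFn_riemannSum {X : ℝ → Ω → ℝ} {x : ℝ → Lp ℝ 2 P} {a b : ℝ}
    (hx : ∀ t ∈ Icc a b, X t =ᵐ[P] x t) (f : ℝ → ℝ) {t : ℕ → ℝ} (τ : ℕ → ℝ) {n : ℕ}
    (ht : ∀ i ≤ n, t i ∈ Icc a b) :
    (fun ω ↦ ∑ i ∈ Finset.range n, f (τ i) * (X (t (i + 1)) ω - X (t i) ω)) =ᵐ[P]
      (∑ i ∈ Finset.range n, f (τ i) • (x (t (i + 1)) - x (t i)) : Lp ℝ 2 P) := by
  induction n with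
  | zero => simpa using! (Lp.coeFn_zero ℝ 2 P).symm
  | succ n ih =>
    rw [Finset.sum_range_succ]
    filter_upwards [ih fun i hi ↦ ht i (by omega), hx _ (ht n (by omega)),
      hx _ (ht (n + 1) le_rfl), Lp.coeFn_add (∑ i ∈ Finset.range n, f (τ i) •
        (x (t (i + 1)) - x (t i))) (f (τ n) • (x (t (n + 1)) - x (t n))),
      Lp.coeFn_smul (f (τ n)) (x (t (n + 1)) - x (t n)), Lp.coeFn_sub (x (t (n + 1))) (x (t n))]
      with ω h1 h2 h3 h4 h5 h6
    rw [h4, Pi.add_apply, ← h1, h5, Pi.smul_apply, h6, Pi.sub_apply, ← h2, ← h3,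
      Finset.sum_range_succ, smul_eq_mul]

lemma eLpNorm_sub_lt_iff {F G : Ω → ℝ} {φ ψ : Lp ℝ 2 P} (hF : F =ᵐ[P] φ) (hG : G =ᵐ[P] ψ) {ε : ℝ}
    (hε : 0 < ε) : eLpNorm (fun ω ↦ F ω - G ω) 2 P < ENNReal.ofReal ε ↔ ‖φ - ψ‖ < ε := by
  have : (fun ω ↦ F ω - G ω) =ᵐ[P] (φ - ψ : Lp ℝ 2 P) := by
    filter_upwards [hF, hG, Lp.coeFn_sub φ ψ] with ω h1 h2 h3
    rw [h3, Pi.sub_apply, h1, h2]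
  rw [eLpNorm_congr_ae this, ← Lp.enorm_def, ← ofReal_norm, ENNReal.ofReal_lt_ofReal_iff hε]

lemma hasRSLimit_iff_hasStochIntegral {X : ℝ → Ω → ℝ} {x : ℝ → Lp ℝ 2 P} {a b : ℝ}
    (hx : ∀ t ∈ Icc a b, X t =ᵐ[P] x t) (f : ℝ → ℝ) {J : Ω → ℝ} {j : Lp ℝ 2 P} (hJ : J =ᵐ[P] j) :
    HasRSLimit x f a b j ↔ HasStochIntegral P X f a b J := by
  have key : ∀ (ε : ℝ), 0 < ε → ∀ (n : ℕ) (t τ : ℕ → ℝ), Monotone t → t 0 = a → t n = b →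
      (eLpNorm (fun ω ↦ (∑ i ∈ Finset.range n, f (τ i) * (X (t (i + 1)) ω - X (t i) ω)) - J ω) 2 P
        < ENNReal.ofReal ε ↔
      ‖(∑ i ∈ Finset.range n, f (τ i) • (x (t (i + 1)) - x (t i))) - j‖ < ε) := by
    intro ε hε n t τ ht h0 hn
    refine eLpNorm_sub_lt_iff (coeFn_riemannSum hx f τ fun i hi ↦ ⟨?_, ?_⟩) hJ hε
    · exact h0 ▸ ht (Nat.zero_le i)
    · exact hn ▸ ht hi
  constructor
  · intro h
    refine ⟨(Lp.memLp j).ae_eq hJ.symm, fun ε hε ↦ ?_⟩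
    obtain ⟨δ, hδ, H⟩ := h ε hε
    exact ⟨δ, hδ, fun n t τ ht h0 hn hm hτ ↦ (key ε hε n t τ ht h0 hn).2 (H n t τ ht h0 hn hm hτ)⟩
  · intro h ε hε
    obtain ⟨δ, hδ, H⟩ := h.tendsto ε hε
    exact ⟨δ, hδ, fun n t τ ht h0 hn hm hτ ↦ (key ε hε n t τ ht h0 hn).1 (H n t τ ht h0 hn hm hτ)⟩

lemma hasStochIntegral_iff_ae_eq {X : ℝ → Ω → ℝ} {x : ℝ → Lp ℝ 2 P} {a b : ℝ} (hab : a ≤ b)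
    (hx : ∀ t ∈ Icc a b, X t =ᵐ[P] x t) {f : ℝ → ℝ} {j : Lp ℝ 2 P} (hj : HasRSLimit x f a b j)
    (J : Ω → ℝ) : HasStochIntegral P X f a b J ↔ J =ᵐ[P] j := by
  constructor
  · intro h
    have h1 := (hasRSLimit_iff_hasStochIntegral hx f h.memLp.coeFn_toLp.symm).2 h
    rw [hj.unique hab h1]
    exact h.memLp.coeFn_toLp.symm
  · intro h
    exact (hasRSLimit_iff_hasStochIntegral hx f h).1 hj

/-! ### Measurable versions and path integrals -/

/-- A continuous curve in `L²(P)` has a jointly measurable version: its discretisations along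
sufficiently fine grids converge almost surely at every time. -/
lemma exists_measurable_version [IsProbabilityMeasure P] {y : ℝ → Lp ℝ 2 P}
    (hy : ContinuousOn y (Icc 0 1)) :
    ∃ Y : ℝ → Ω → ℝ, Measurable (Function.uncurry Y) ∧ ∀ r ∈ Icc (0 : ℝ) 1, Y r =ᵐ[P] y r := by
  have huc := isCompact_Icc.uniformContinuousOn_of_continuous hy
  have hgrid : ∀ k : ℕ, ∃ n : ℕ, 0 < n ∧ ∀ r ∈ Icc (0 : ℝ) 1, ∀ s ∈ Icc (0 : ℝ) 1,
      |r - s| ≤ 1 / n → ‖y r - y s‖ ≤ (1 / 2) ^ k := by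
    intro k
    obtain ⟨δ, hδ, H⟩ := Metric.uniformContinuousOn_iff.1 huc ((1 / 2) ^ k) (by positivity)
    obtain ⟨n, hn⟩ := exists_nat_one_div_lt hδ
    refine ⟨n + 1, Nat.succ_pos n, fun r hr s hs hrs ↦ ?_⟩
    rw [← dist_eq_norm]
    refine (H r hr s hs ?_).le
    rw [Real.dist_eq]
    push_cast at hrs
    exact hrs.trans_lt hn
  choose n hn hH using hgrid
  let Z : ℕ → ℝ × Ω → ℝ := fun k p ↦ y (⌊n k * p.1⌋ / n k) p.2
  have hZ : ∀ k, Measurable (Z k) := by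
    intro k
    have h1 : Measurable fun q : ℤ × Ω ↦ (y (q.1 / n k) : Lp ℝ 2 P) q.2 :=
      measurable_from_prod_countable_right fun m ↦ (Lp.stronglyMeasurable (y (m / n k))).measurable
    exact h1.comp (((measurable_fst.const_mul (n k : ℝ)).floor).prodMk measurable_snd)
  refine ⟨fun r ω ↦ limsup (fun k ↦ Z k (r, ω)) atTop, Measurable.limsup hZ, fun r hr ↦ ?_⟩
  have hd : ∀ k, ‖y (⌊n k * r⌋ / n k) - y r‖ ≤ (1 / 2) ^ k := by
    intro k
    have hnk : (0 : ℝ) < n k := by exact_mod_cast hn k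
    have h1 : ((⌊n k * r⌋ : ℤ) : ℝ) / n k ≤ r := by
      rw [div_le_iff₀ hnk, mul_comm]; exact Int.floor_le _
    have h2 : r ≤ (⌊n k * r⌋ : ℤ) / n k + 1 / n k := by
      rw [← add_div, le_div_iff₀ hnk, mul_comm]; exact (Int.lt_floor_add_one _).le
    have h3 : (0 : ℝ) ≤ (⌊n k * r⌋ : ℤ) / n k := by
      have : (0 : ℤ) ≤ ⌊n k * r⌋ := Int.floor_nonneg.2 (mul_nonneg hnk.le hr.1)
      have : (0 : ℝ) ≤ (⌊n k * r⌋ : ℤ) := by exact_mod_cast this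
      positivity
    refine hH k _ ⟨h3, h1.trans hr.2⟩ r hr ?_
    rw [abs_le]
    have : (0 : ℝ) ≤ 1 / n k := by positivity
    constructor <;> linarith
  have hsum : ∑' k, ∫⁻ ω, ‖y (⌊n k * r⌋ / n k) ω - y r ω‖ₑ ∂P ≠ ∞ := by
    have hle : ∀ k, ∫⁻ ω, ‖y (⌊n k * r⌋ / n k) ω - y r ω‖ₑ ∂P ≤ ENNReal.ofReal ((1 / 2) ^ k) := by
      intro k
      calc ∫⁻ ω, ‖y (⌊n k * r⌋ / n k) ω - y r ω‖ₑ ∂P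
          = eLpNorm (y (⌊n k * r⌋ / n k) - y r : Lp ℝ 2 P) 1 P := by
            rw [eLpNorm_one_eq_lintegral_enorm]
            refine lintegral_congr_ae ?_
            filter_upwards [Lp.coeFn_sub (y (⌊n k * r⌋ / n k)) (y r)] with ω hω
            rw [hω, Pi.sub_apply]
        _ ≤ eLpNorm (y (⌊n k * r⌋ / n k) - y r : Lp ℝ 2 P) 2 P :=
            eLpNorm_le_eLpNorm_of_exponent_le (by norm_num) (Lp.aestronglyMeasurable _)
        _ ≤ _ := by
            rw [← Lp.enorm_def, ← ofReal_norm]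
            exact ENNReal.ofReal_le_ofReal (hd k)
    refine ne_top_of_le_ne_top ?_ (ENNReal.tsum_le_tsum hle)
    rw [← ENNReal.ofReal_tsum_of_nonneg (fun k ↦ by positivity) summable_geometric_two]
    exact ENNReal.ofReal_ne_top
  have hm : ∀ k, AEMeasurable (fun ω ↦ ‖y (⌊n k * r⌋ / n k) ω - y r ω‖ₑ) P := fun k ↦
    ((Lp.aestronglyMeasurable _).sub (Lp.aestronglyMeasurable _)).enorm
  rw [← lintegral_tsum hm] at hsum
  filter_upwards [ae_lt_top' (AEMeasurable.tsum hm) hsum] with ω hω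
  have hlim := ENNReal.tendsto_atTop_zero_of_tsum_ne_top hω.ne
  refine Tendsto.limsup_eq (tendsto_iff_edist_tendsto_0.2 ?_)
  simpa only [edist_eq_enorm_sub] using hlim

/-- The path integral of a jointly measurable version of a continuous curve in `L²(P)` exists
almost surely, and is a version of the integral of the curve. -/
lemma integral_version [IsProbabilityMeasure P] {y : ℝ → Lp ℝ 2 P} {Y : ℝ → Ω → ℝ} {c : ℝ}
    (hc : 0 ≤ c) (hy : ContinuousOn y (Icc 0 c)) (hY : Measurable (Function.uncurry Y))
    (hYy : ∀ r ∈ Icc (0 : ℝ) c, Y r =ᵐ[P] y r) :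
    (∀ᵐ ω ∂P, IntervalIntegrable (fun r ↦ Y r ω) volume 0 c) ∧
      (fun ω ↦ ∫ r in (0 : ℝ)..c, Y r ω) =ᵐ[P] (∫ r in (0 : ℝ)..c, y r : Lp ℝ 2 P) := by
  obtain ⟨M, hM⟩ := isCompact_Icc.exists_bound_of_continuousOn hy
  have hmem : ∀ᵐ r ∂(volume.restrict (Ioc 0 c)), r ∈ Icc 0 c := by
    filter_upwards [ae_restrict_mem measurableSet_Ioc] with r hr using ⟨hr.1.le, hr.2⟩
  have hLp : ∀ φ : Lp ℝ 2 P, Integrable φ P := fun φ ↦ (Lp.memLp φ).integrable (by norm_num)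
  have hint : Integrable (Function.uncurry Y) ((volume.restrict (Ioc 0 c)).prod P) := by
    rw [integrable_prod_iff hY.aestronglyMeasurable]
    constructor
    · filter_upwards [hmem] with r hr
      exact (hLp (y r)).congr (hYy r hr).symm
    · refine Integrable.of_bound (C := M)
        hY.norm.stronglyMeasurable.integral_prod_right.aestronglyMeasurable ?_
      filter_upwards [hmem] with r hr
      rw [Real.norm_of_nonneg (by positivity)]
      calc ∫ ω, ‖Function.uncurry Y (r, ω)‖ ∂P = ∫ ω, ‖y r ω‖ ∂P := by
            refine integral_congr_ae ?_
            filter_upwards [hYy r hr] with ω hω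
            simp [hω]
        _ ≤ ‖y r‖ := by
            rw [integral_norm_eq_lintegral_enorm (Lp.aestronglyMeasurable _), Lp.norm_def,
              ← eLpNorm_one_eq_lintegral_enorm]
            exact ENNReal.toReal_mono (Lp.memLp _).eLpNorm_ne_top
              (eLpNorm_le_eLpNorm_of_exponent_le (by norm_num) (Lp.aestronglyMeasurable _))
        _ ≤ M := hM r hr
  have hyi : IntervalIntegrable y volume 0 c := by
    apply ContinuousOn.intervalIntegrable; rwa [uIcc_of_le hc]
  refine ⟨?_, ?_⟩
  · filter_upwards [hint.prod_left_ae] with ω hω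
    rw [intervalIntegrable_iff_integrableOn_Ioc_of_le hc]
    exact hω
  · refine Integrable.ae_eq_of_forall_setIntegral_eq _ _ ?_ (hLp _) fun S hS _ ↦ ?_
    · simp_rw [intervalIntegral.integral_of_le hc]
      exact hint.integral_prod_right
    have hS' : P S ≠ ∞ := measure_ne_top P S
    rw [← L2.inner_indicatorConstLp_one (𝕜 := ℝ) hS hS',
      ← innerSL_apply_apply ℝ (indicatorConstLp 2 hS hS' (1 : ℝ)),
      ← ContinuousLinearMap.intervalIntegral_comp_comm _ hyi]
    simp_rw [intervalIntegral.integral_of_le hc]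
    rw [integral_integral_swap]
    · refine integral_congr_ae ?_
      filter_upwards [hmem] with r hr
      rw [innerSL_apply_apply, L2.inner_indicatorConstLp_one]
      exact integral_congr_ae (ae_restrict_of_ae (hYy r hr))
    · exact hint.swap.mono_measure (μ := (P.restrict S).prod (volume.restrict (Ioc 0 c)))
        (Measure.prod_mono Measure.restrict_le_self le_rfl)

/-! ### The left limit at time `1` -/

/-- The paths over the rational times of `[0, 1)` that are Cauchy at time `1`. -/
def cauchyPaths : Set ({q : ℚ // (q : ℝ) ∈ Ico (0 : ℝ) 1} → ℝ) :=
  {x | ∀ k : ℕ, ∃ m : ℕ, ∀ p q : {q : ℚ // (q : ℝ) ∈ Ico (0 : ℝ) 1},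
    1 - 1 / ((m : ℝ) + 1) < (p : ℚ) → 1 - 1 / ((m : ℝ) + 1) < (q : ℚ) →
      |x p - x q| ≤ 1 / ((k : ℝ) + 1)}

lemma measurableSet_cauchyPaths : MeasurableSet cauchyPaths := by
  simp only [cauchyPaths, ofPred_forall, ofPred_exists]
  refine MeasurableSet.iInter fun k ↦ MeasurableSet.iUnion fun m ↦ MeasurableSet.iInter fun p ↦
    MeasurableSet.iInter fun q ↦ MeasurableSet.iInter fun _ ↦ MeasurableSet.iInter fun _ ↦ ?_
  refine measurableSet_le ?_ measurable_const
  exact (((measurable_pi_apply p).sub (measurable_pi_apply q))).abs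

lemma mem_cauchyPaths_of_continuousOn {x : ℝ → ℝ} (hx : ContinuousOn x (Icc 0 1)) :
    (fun q : {q : ℚ // (q : ℝ) ∈ Ico (0 : ℝ) 1} ↦ x (q : ℚ)) ∈ cauchyPaths := by
  intro k
  have h1 := Metric.continuousWithinAt_iff.1 (hx 1 (by simp)) (1 / ((k : ℝ) + 1) / 2) (by positivity)
  obtain ⟨δ, hδ, H⟩ := h1
  obtain ⟨m, hm⟩ := exists_nat_one_div_lt hδ
  refine ⟨m, fun p q hp hq ↦ ?_⟩
  have key : ∀ q : {q : ℚ // (q : ℝ) ∈ Ico (0 : ℝ) 1}, 1 - 1 / ((m : ℝ) + 1) < (q : ℚ) →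
      dist (x (q : ℚ)) (x 1) < 1 / ((k : ℝ) + 1) / 2 := fun q hq ↦ by
    refine H ⟨q.2.1, q.2.2.le⟩ ?_
    rw [Real.dist_eq, abs_lt]
    constructor <;> linarith [q.2.2]
  rw [← Real.dist_eq]
  linarith [dist_triangle_right (x (p : ℚ)) (x (q : ℚ)) (x 1), key p hp, key q hq]

lemma exists_tendsto_of_mem_cauchyPaths {x : ℝ → ℝ} (hx : ContinuousOn x (Ico 0 1))
    (h : (fun q : {q : ℚ // (q : ℝ) ∈ Ico (0 : ℝ) 1} ↦ x (q : ℚ)) ∈ cauchyPaths) :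
    ∃ l, Tendsto x (𝓝[<] 1) (𝓝 l) := by
  refine CompleteSpace.complete (f := map x (𝓝[<] 1)) ?_
  rw [Metric.cauchy_iff]
  refine ⟨inferInstance, fun ε hε ↦ ?_⟩
  obtain ⟨k, hk⟩ := exists_nat_one_div_lt hε
  obtain ⟨m, hm⟩ := h k
  have hm0 : (0 : ℝ) < 1 / ((m : ℝ) + 1) := by positivity
  set S := {t : ℝ | t ∈ Ico (0 : ℝ) 1 ∧ 1 - 1 / ((m : ℝ) + 1) < t} with hS
  -- each point of `S` is a limit of rational points of `S`
  have happrox : ∀ s ∈ S, ∃ u : ℕ → {q : ℚ // (q : ℝ) ∈ Ico (0 : ℝ) 1},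
      (∀ i, 1 - 1 / ((m : ℝ) + 1) < ((u i : ℚ) : ℝ)) ∧
      Tendsto (fun i ↦ x ((u i : ℚ) : ℝ)) atTop (𝓝 (x s)) := by
    intro s hs
    have h1 : ∀ i : ℕ, ∃ q : ℚ, s < q ∧ (q : ℝ) < min 1 (s + 1 / ((i : ℝ) + 1)) := fun i ↦
      exists_rat_btwn (lt_min hs.1.2 (by linarith [show (0 : ℝ) < 1 / ((i : ℝ) + 1) by positivity]))
    choose q hq1 hq2 using h1
    refine ⟨fun i ↦ ⟨q i, hs.1.1.trans (hq1 i).le, (hq2 i).trans_le (min_le_left _ _)⟩,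
      fun i ↦ hs.2.trans (hq1 i), ?_⟩
    have hlim : Tendsto (fun i ↦ (q i : ℝ)) atTop (𝓝 s) := by
      refine tendsto_of_tendsto_of_tendsto_of_le_of_le tendsto_const_nhds
        (h := fun i : ℕ ↦ s + 1 / ((i : ℝ) + 1)) ?_ (fun i ↦ (hq1 i).le)
        fun i ↦ (hq2 i).le.trans (min_le_right _ _)
      simpa using tendsto_const_nhds.add (tendsto_one_div_add_atTop_nhds_zero_nat (𝕜 := ℝ))
    refine (hx s hs.1).tendsto.comp (tendsto_nhdsWithin_iff.2 ⟨hlim, Eventually.of_forall fun i ↦ ?_⟩)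
    exact ⟨hs.1.1.trans (hq1 i).le, (hq2 i).trans_le (min_le_left _ _)⟩
  refine ⟨x '' S, image_mem_map ?_, ?_⟩
  · filter_upwards [self_mem_nhdsWithin, mem_nhdsWithin_of_mem_nhds (Ioi_mem_nhds zero_lt_one),
      mem_nhdsWithin_of_mem_nhds (Ioi_mem_nhds (show 1 - 1 / ((m : ℝ) + 1) < 1 by linarith))]
      with t h1 h2 h3 using ⟨⟨le_of_lt h2, h1⟩, h3⟩
  · rintro _ ⟨s, hs, rfl⟩ _ ⟨t, ht, rfl⟩
    obtain ⟨u, hu, hu'⟩ := happrox s hs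
    obtain ⟨u', hv, hv'⟩ := happrox t ht
    rw [Real.dist_eq]
    exact (le_of_tendsto (hu'.sub hv').abs (Eventually.of_forall fun i ↦
      hm _ _ (hu i) (hv i))).trans_lt hk

/-- A process on `[0, 1)` with continuous paths and the covariance of the Wiener process has a left
limit at time `1` almost surely, since its law over the rational times is that of the Wiener
process. -/
lemma IsWienerIntegral.exists_tendsto [IsProbabilityMeasure P] {W : ℝ → Ω → ℝ}
    (hW : IsWienerProcess W P) {J : L2I →ₗᵢ[ℝ] Lp ℝ 2 P} (hJ : IsWienerIntegral W P J) {v : ℝ → L2I}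
    (hv : ∀ s ∈ Ico (0 : ℝ) 1, ∀ t ∈ Ico (0 : ℝ) 1, ⟪v s, v t⟫ = min s t) {w : ℝ → Ω → ℝ}
    (hw : ∀ t ∈ Ico (0 : ℝ) 1, w t =ᵐ[P] J (v t))
    (hc : ∀ᵐ ω ∂P, ContinuousOn (fun t ↦ w t ω) (Ico 0 1)) :
    ∀ᵐ ω ∂P, ∃ l, Tendsto (fun t ↦ w t ω) (𝓝[<] 1) (𝓝 l) := by
  let D := {q : ℚ // (q : ℝ) ∈ Ico (0 : ℝ) 1}
  have hD : ∀ q : D, ((q : ℚ) : ℝ) ∈ Icc (0 : ℝ) 1 := fun q ↦ ⟨q.2.1, q.2.2.le⟩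
  have hmw : AEMeasurable (fun ω (q : D) ↦ w (q : ℚ) ω) P := aemeasurable_pi_lambda _ fun q ↦
    (Lp.aestronglyMeasurable _).aemeasurable.congr (hw _ q.2).symm
  have hmW : AEMeasurable (fun ω (q : D) ↦ W (q : ℚ) ω) P := aemeasurable_pi_lambda _ fun q ↦
    (Lp.aestronglyMeasurable _).aemeasurable.congr (hJ.cut_one _ (hD q))
  have hmap : P.map (fun ω (q : D) ↦ w (q : ℚ) ω) = P.map (fun ω (q : D) ↦ W (q : ℚ) ω) := by
    refine (map_eq_iff_forall_finset_map_restrict_eq (X := fun q : D ↦ w (q : ℚ))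
      (Y := fun q : D ↦ W (q : ℚ)) hmw hmW).2 fun I ↦ ?_
    refine hJ.map_eq_of_gram (φ := fun q : I ↦ v ((q : D) : ℚ))
      (ψ := fun q : I ↦ cut 1 ((q : D) : ℚ)) (fun p q ↦ ?_) (fun q ↦ hw _ q.1.2)
      (fun q ↦ (hJ.cut_one _ (hD q)).symm)
    rw [hv _ p.1.2 _ q.1.2, inner_cut_one (hD p) (hD q)]
  have hWc : ∀ᵐ x ∂(P.map (fun ω (q : D) ↦ W (q : ℚ) ω)), x ∈ cauchyPaths := by
    rw [ae_map_iff (p := fun x ↦ x ∈ cauchyPaths) hmW measurableSet_cauchyPaths]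
    filter_upwards [hW.cont] with ω hω using mem_cauchyPaths_of_continuousOn hω
  rw [← hmap, ae_map_iff (p := fun x ↦ x ∈ cauchyPaths) hmw measurableSet_cauchyPaths] at hWc
  filter_upwards [hWc, hc] with ω h1 h2 using exists_tendsto_of_mem_cauchyPaths h2 h1


/-! ### The kernel -/

lemma phi_system_fst (I1 I2 I3 I4 I5 h g : ℝ) :
    phi1Poly I1 I2 I3 I4 I5 h g * (1 - I2 + I4) + psi2Poly I1 I2 I3 I4 I5 h g * (I2 - I1) =
      (g - h) * phi2Poly I1 I2 I3 I4 I5 h g := by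
  unfold phi1Poly psi2Poly phi2Poly; ring

lemma phi_system_snd (I1 I2 I3 I4 I5 h g : ℝ) :
    -phi1Poly I1 I2 I3 I4 I5 h g * I4 + psi2Poly I1 I2 I3 I4 I5 h g * (1 - I2) =
      h * phi2Poly I1 I2 I3 I4 I5 h g := by
  unfold phi1Poly psi2Poly phi2Poly; ring

lemma continuous_phi (h g : C(ℝ, ℝ)) :
    Continuous (phi1 h g) ∧ Continuous (phi2 h g) ∧ Continuous (psi2 h g) := by
  have hc : ∀ f : ℝ → ℝ, Continuous f → Continuous fun r ↦ ∫ q in (0 : ℝ)..r, f q := fun f hf ↦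
    intervalIntegral.continuous_primitive (fun a b ↦ hf.intervalIntegrable a b) 0
  have c1 : Continuous (int1 g) := hc _ (by fun_prop)
  have c2 : Continuous (int2 h g) := hc _ (by fun_prop)
  have c3 : Continuous (int3 h) := hc _ (by fun_prop)
  have c4 : Continuous (int4 h) := hc _ (by fun_prop)
  have c5 : Continuous (int5 g) := hc _ (by fun_prop)
  have ch := h.continuous
  have cg := g.continuous
  unfold phi1 phi2 psi2 phi1Poly phi2Poly psi2Poly
  exact ⟨by fun_prop, by fun_prop, by fun_prop⟩

lemma phi_congr {h g h' g' : ℝ → ℝ} (hh : ∀ q ∈ Icc (0 : ℝ) 1, h' q = h q)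
    (hg : ∀ q ∈ Icc (0 : ℝ) 1, g' q = g q) {r : ℝ} (hr : r ∈ Icc (0 : ℝ) 1) :
    phi1 h' g' r = phi1 h g r ∧ phi2 h' g' r = phi2 h g r ∧ psi2 h' g' r = psi2 h g r := by
  have hm : ∀ q ∈ uIcc 0 r, q ∈ Icc (0 : ℝ) 1 := fun q hq ↦ by
    rw [uIcc_of_le hr.1] at hq; exact ⟨hq.1, hq.2.trans hr.2⟩
  have c1 : int1 g' r = int1 g r := intervalIntegral.integral_congr fun q hq ↦ by
    simp only [hg q (hm q hq)]
  have c2 : int2 h' g' r = int2 h g r := intervalIntegral.integral_congr fun q hq ↦ by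
    simp only [hg q (hm q hq), hh q (hm q hq)]
  have c3 : int3 h' r = int3 h r := intervalIntegral.integral_congr fun q hq ↦ by
    simp only [hh q (hm q hq)]
  have c4 : int4 h' r = int4 h r := intervalIntegral.integral_congr fun q hq ↦ by
    simp only [hh q (hm q hq)]
  have c5 : int5 g' r = int5 g r := intervalIntegral.integral_congr fun q hq ↦ by
    simp only [hg q (hm q hq)]
  simp only [phi1, phi2, psi2, c1, c2, c3, c4, c5, hh r hr, hg r hr, and_self]

lemma kernelSystem_phi {h g : C(ℝ, ℝ)} (hnorm : ∫ q in (0 : ℝ)..1, g q ^ 2 = 1)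
    (hφ : ∀ r ∈ Ico (0 : ℝ) 1, 0 < phi2 h g r) :
    KernelSystem h g (fun r ↦ phi1 h g r / phi2 h g r) (fun r ↦ psi2 h g r / phi2 h g r) := by
  obtain ⟨c1, c2, c3⟩ := continuous_phi h g
  refine ⟨hnorm, c1.continuousOn.div c2.continuousOn fun r hr ↦ (hφ r hr).ne',
    c3.continuousOn.div c2.continuousOn fun r hr ↦ (hφ r hr).ne', fun r hr ↦ ?_, fun r hr ↦ ?_⟩
  · have := phi_system_fst (int1 g r) (int2 h g r) (int3 h r) (int4 h r) (int5 g r) (h r) (g r)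
    have h0 := (hφ r hr).ne'
    field_simp
    simp only [phi1, phi2, psi2]
    linarith
  · have := phi_system_snd (int1 g r) (int2 h g r) (int3 h r) (int4 h r) (int5 g r) (h r) (g r)
    have h0 := (hφ r hr).ne'
    field_simp
    simp only [phi1, phi2, psi2]
    linarith

lemma exists_continuousMap_eqOn {f : ℝ → ℝ} (hf : ContinuousOn f (Icc 0 1)) :
    ∃ f' : C(ℝ, ℝ), ∀ q ∈ Icc (0 : ℝ) 1, f' q = f q :=
  ⟨⟨IccExtend zero_le_one ((Icc 0 1).domRestrict f), hf.domRestrict.Icc_extend'⟩, fun _ hq ↦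
    IccExtend_of_mem zero_le_one ((Icc 0 1).domRestrict f) hq⟩

/-! ### The transformed process -/

variable {W : ℝ → Ω → ℝ} {J : L2I →ₗᵢ[ℝ] Lp ℝ 2 P} {h g : ℝ → ℝ} {h' g' : C(ℝ, ℝ)}

lemma IsWienerIntegral.hasStochIntegral_iff (hJ : IsWienerIntegral W P J)
    (hg : ∀ q ∈ Icc (0 : ℝ) 1, g' q = g q) (ξ : Ω → ℝ) :
    HasStochIntegral P W g 0 1 ξ ↔ ξ =ᵐ[P] J (cut g' 1) :=
  hasStochIntegral_iff_ae_eq zero_le_one (fun t ht ↦ (hJ.cut_one t ht).symm)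
    (((hasRSLimit_cut g' (by simp)).map J.toContinuousLinearMap).congr (fun _ _ ↦ rfl) hg) ξ

lemma IsWienerIntegral.limitProcess_ae_eq (hJ : IsWienerIntegral W P J)
    (hh : ∀ q ∈ Icc (0 : ℝ) 1, h' q = h q) {ξ : Ω → ℝ} (hξ : ξ =ᵐ[P] J (cut g' 1)) {t : ℝ}
    (ht : t ∈ Icc (0 : ℝ) 1) : limitProcess W ξ h t =ᵐ[P] J (pert h' g' (cut 1 t)) := by
  have hi : ⟪cut h' 1, cut 1 t⟫ = ∫ q in (0 : ℝ)..t, h q := by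
    rw [inner_cut_one_left _ _ ht]
    refine intervalIntegral.integral_congr fun q hq ↦ ?_
    rw [uIcc_of_le ht.1] at hq
    simp [hh q ⟨hq.1, hq.2.trans ht.2⟩]
  rw [pert_apply, map_sub, map_smul, hi]
  filter_upwards [hJ.cut_one t ht, hξ, Lp.coeFn_sub (J (cut 1 t))
    ((∫ q in (0 : ℝ)..t, h q) • J (cut g' 1)),
    Lp.coeFn_smul (∫ q in (0 : ℝ)..t, h q) (J (cut g' 1))] with ω h1 h2 h3 h4
  rw [h3, Pi.sub_apply, h1, h4, Pi.smul_apply, ← h2, limitProcess, smul_eq_mul, mul_comm]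

lemma IsWienerIntegral.hasStochIntegral_kernel_iff (hJ : IsWienerIntegral W P J)
    (hh : ∀ q ∈ Icc (0 : ℝ) 1, h' q = h q) (hg : ∀ q ∈ Icc (0 : ℝ) 1, g' q = g q) {ξ : Ω → ℝ}
    (hξ : ξ =ᵐ[P] J (cut g' 1)) {r : ℝ} (hr : r ∈ Ico (0 : ℝ) 1) (Y : Ω → ℝ) :
    HasStochIntegral P (limitProcess W ξ h) (kernel h g r) 0 r Y ↔
      Y =ᵐ[P] J (pert h' g' (kerVec h' g' (fun r ↦ phi1 h' g' r / phi2 h' g' r)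
        (fun r ↦ psi2 h' g' r / phi2 h' g' r) r)) := by
  have hr' : r ∈ Icc (0 : ℝ) 1 := ⟨hr.1, hr.2.le⟩
  obtain ⟨e1, e2, e3⟩ := phi_congr hh hg hr'
  refine hasStochIntegral_iff_ae_eq hr.1 (fun t ht ↦
    hJ.limitProcess_ae_eq hh hξ ⟨ht.1, ht.2.trans hr'.2⟩) ?_ Y
  have := ((hasRSLimit_cut ((phi1 h' g' r / phi2 h' g' r) • h' + (psi2 h' g' r / phi2 h' g' r) • g')
    hr').map (pert h' g')).map J.toContinuousLinearMap
  rw [cut_add, cut_smul, cut_smul] at this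
  refine this.congr (fun _ _ ↦ rfl) fun q hq ↦ ?_
  have hq' : q ∈ Icc (0 : ℝ) 1 := ⟨hq.1, hq.2.trans hr'.2⟩
  simp only [ContinuousMap.add_apply, ContinuousMap.smul_apply, smul_eq_mul, kernel, e1, e2, e3,
    hh q hq', hg q hq']
  ring

/-- The inner integral has a jointly measurable version. -/
lemma IsWienerIntegral.exists_isInnerIntegral [IsProbabilityMeasure P] (hJ : IsWienerIntegral W P J)
    (hh : ∀ q ∈ Icc (0 : ℝ) 1, h' q = h q) (hg : ∀ q ∈ Icc (0 : ℝ) 1, g' q = g q) {ξ : Ω → ℝ}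
    (hξ : ξ =ᵐ[P] J (cut g' 1)) :
    ∃ Y : ℝ → Ω → ℝ, IsInnerIntegral P h g (limitProcess W ξ h) Y := by
  have hcont : ∀ f : C(ℝ, ℝ), ContinuousOn (fun r ↦ J (pert h' g' (cut f r))) (Icc 0 1) := fun f ↦
    (J.continuous.comp (pert h' g').continuous).comp_continuousOn (continuousOn_cut f)
  obtain ⟨Yh, mh, hYh⟩ := exists_measurable_version (hcont h')
  obtain ⟨Yg, mg, hYg⟩ := exists_measurable_version (hcont g')
  obtain ⟨c1, c2, c3⟩ := continuous_phi h' g'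
  refine ⟨fun r ω ↦ phi1 h' g' r / phi2 h' g' r * Yh r ω + psi2 h' g' r / phi2 h' g' r * Yg r ω,
    ?_, fun r hr ↦ ?_⟩
  · exact (((c1.measurable.div c2.measurable).comp measurable_fst).mul mh).add
      (((c3.measurable.div c2.measurable).comp measurable_fst).mul mg)
  · have hr' : r ∈ Icc (0 : ℝ) 1 := ⟨hr.1, hr.2.le⟩
    rw [hJ.hasStochIntegral_kernel_iff hh hg hξ hr, kerVec, map_add, map_smul, map_smul, map_add,
      map_smul, map_smul]
    filter_upwards [hYh r hr', hYg r hr', Lp.coeFn_add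
      ((phi1 h' g' r / phi2 h' g' r) • J (pert h' g' (cut h' r)))
      ((psi2 h' g' r / phi2 h' g' r) • J (pert h' g' (cut g' r))),
      Lp.coeFn_smul (phi1 h' g' r / phi2 h' g' r) (J (pert h' g' (cut h' r))),
      Lp.coeFn_smul (psi2 h' g' r / phi2 h' g' r) (J (pert h' g' (cut g' r)))] with ω a1 a2 a3 a4 a5
    rw [a3, Pi.add_apply, a4, a5, Pi.smul_apply, Pi.smul_apply, ← a1, ← a2, smul_eq_mul,
      smul_eq_mul]

/-- For every version of the inner integral, the transformed process is well defined and is a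
Wiener process. -/
lemma IsWienerIntegral.exists_isTransform [IsProbabilityMeasure P] (hW : IsWienerProcess W P)
    (hJ : IsWienerIntegral W P J)
    (hh : ∀ q ∈ Icc (0 : ℝ) 1, h' q = h q) {a b : ℝ → ℝ} (K : KernelSystem h' g' a b) {ξ : Ω → ℝ} (hξ : ξ =ᵐ[P] J (cut g' 1))
    {Y : ℝ → Ω → ℝ} (hYm : Measurable (Function.uncurry Y))
    (hY : ∀ r ∈ Ico (0 : ℝ) 1, Y r =ᵐ[P] J (pert h' g' (kerVec h' g' a b r))) :
    ∃ w : ℝ → Ω → ℝ, IsTransform P (limitProcess W ξ h) Y w ∧ IsWienerProcess w P := by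
  set U := limitProcess W ξ h with hU
  have hcont : ContinuousOn (fun r ↦ J (pert h' g' (kerVec h' g' a b r))) (Ico 0 1) :=
    J.continuous.comp_continuousOn (continuousOn_pert_kerVec K)
  have hver : ∀ c ∈ Ico (0 : ℝ) 1, _ := fun c (hc : c ∈ Ico (0 : ℝ) 1) ↦
    integral_version hc.1 (hcont.mono fun x hx ↦ ⟨hx.1, hx.2.trans_lt hc.2⟩) hYm
      fun r hr ↦ hY r ⟨hr.1, hr.2.trans_lt hc.2⟩
  set w₀ : ℝ → Ω → ℝ := fun ν ω ↦ U ν ω + ∫ r in (0 : ℝ)..ν, Y r ω with hw₀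
  have hw₀v : ∀ t ∈ Ico (0 : ℝ) 1, w₀ t =ᵐ[P] J (innovVec h' g' a b t) := by
    intro t ht
    have hint : ∫ r in (0 : ℝ)..t, J (pert h' g' (kerVec h' g' a b r)) =
        J (∫ r in (0 : ℝ)..t, pert h' g' (kerVec h' g' a b r)) :=
      J.toContinuousLinearMap.intervalIntegral_comp_comm
        (intervalIntegrable_pert_kerVec K (by simp) ht)
    rw [innovVec, map_add, ← hint]
    filter_upwards [hJ.limitProcess_ae_eq hh hξ ⟨ht.1, ht.2.le⟩, (hver t ht).2,
      Lp.coeFn_add (J (pert h' g' (cut 1 t)))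
        (∫ r in (0 : ℝ)..t, J (pert h' g' (kerVec h' g' a b r)))] with ω h1 h2 h3
    rw [h3, Pi.add_apply, ← h1, ← h2]
  -- the path integrals over all intervals `[0, ν]` exist outside one null set
  have hint : ∀ᵐ ω ∂P, ∀ ν ∈ Ico (0 : ℝ) 1, IntervalIntegrable (fun r ↦ Y r ω) volume 0 ν := by
    have h1 : ∀ᵐ ω ∂P, ∀ n : ℕ, IntervalIntegrable (fun r ↦ Y r ω) volume 0 (1 - 1 / ((n : ℝ) + 1)) :=
      ae_all_iff.2 fun n ↦ (hver _ ⟨sub_nonneg.2 (by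
        rw [div_le_one (by positivity)]; linarith [n.cast_nonneg (α := ℝ)]),
        sub_lt_self _ (by positivity)⟩).1
    filter_upwards [h1] with ω hω ν hν
    obtain ⟨n, hn⟩ := exists_nat_one_div_lt (sub_pos.2 hν.2)
    refine (hω n).mono_set ?_
    rw [uIcc_of_le hν.1, uIcc_of_le (by linarith [hν.1])]
    exact Icc_subset_Icc_right (by linarith)
  have hUc : ∀ᵐ ω ∂P, ContinuousOn (fun t ↦ U t ω) (Icc 0 1) := by
    have hprim : ContinuousOn (fun t ↦ ∫ q in (0 : ℝ)..t, h q) (Icc 0 1) := by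
      have : Continuous fun t ↦ ∫ q in (0 : ℝ)..t, h' q :=
        intervalIntegral.continuous_primitive (fun a b ↦ h'.continuous.intervalIntegrable a b) 0
      refine this.continuousOn.congr fun t ht ↦ intervalIntegral.integral_congr fun q hq ↦ ?_
      rw [uIcc_of_le ht.1] at hq
      exact (hh q ⟨hq.1, hq.2.trans ht.2⟩).symm
    filter_upwards [hW.cont] with ω hω
    exact hω.sub (continuousOn_const.mul hprim)
  have hw₀c : ∀ᵐ ω ∂P, ContinuousOn (fun t ↦ w₀ t ω) (Ico 0 1) := by
    filter_upwards [hUc, hint] with ω h1 h2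
    refine (h1.mono Ico_subset_Icc_self).add fun t ht ↦ ?_
    obtain ⟨c, hc1, hc2⟩ := exists_between ht.2
    have h3 := intervalIntegral.continuousOn_primitive_interval
      (f := fun r ↦ Y r ω) (μ := volume) (a := 0) (b := c)
      (by
        have := h2 c ⟨ht.1.trans hc1.le, hc2⟩
        rw [uIcc_of_le (ht.1.trans hc1.le)]
        rwa [intervalIntegrable_iff_integrableOn_Icc_of_le (ht.1.trans hc1.le)] at this)
    rw [uIcc_of_le (ht.1.trans hc1.le)] at h3
    refine (h3 t ⟨ht.1, hc1.le⟩).mono_of_mem_nhdsWithin ?_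
    filter_upwards [self_mem_nhdsWithin, mem_nhdsWithin_of_mem_nhds (Iio_mem_nhds hc1)]
      with x hx1 hx2 using ⟨hx1.1, le_of_lt hx2⟩
  have hgram : ∀ s ∈ Ico (0 : ℝ) 1, ∀ t ∈ Ico (0 : ℝ) 1,
      ⟪innovVec h' g' a b s, innovVec h' g' a b t⟫ = min s t := fun s hs t ht ↦
    inner_innovVec K hs ht
  have hlim := hJ.exists_tendsto hW hgram hw₀v hw₀c
  obtain ⟨v, hv1, hv2, hv3⟩ := exists_inner_eq_min hgram
  let w : ℝ → Ω → ℝ := fun t ω ↦ if t = 1 then limUnder (𝓝[<] 1) (fun s ↦ w₀ s ω) else w₀ t ω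
  have hlim' : ∀ᵐ ω ∂P, Tendsto (fun t ↦ w₀ t ω) (𝓝[<] 1) (𝓝 (w 1 ω)) := by
    filter_upwards [hlim] with ω hω
    simp only [w, if_true]
    exact tendsto_nhds_limUnder hω
  have hne : ∀ t : ℝ, t ≠ 1 → w t = w₀ t := fun t ht ↦ by funext ω; simp [w, ht]
  refine ⟨w, ?_, hJ.isWienerProcess hW hv3 (w := w) (fun t ht ↦ ?_) ?_⟩
  · filter_upwards [hint, hUc, hlim'] with ω h1 h2 h3
    refine ⟨fun ν hν ↦ ⟨h1 ν hν, by rw [hne ν hν.2.ne]⟩, w 1 ω - U 1 ω, ?_, by ring⟩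
    have hU1 : Tendsto (fun t ↦ U t ω) (𝓝[<] 1) (𝓝 (U 1 ω)) := by
      refine (h2 1 (by simp)).tendsto.mono_left (nhdsWithin_le_of_mem ?_)
      filter_upwards [self_mem_nhdsWithin, mem_nhdsWithin_of_mem_nhds (Ioi_mem_nhds zero_lt_one)]
        with t ht1 ht2 using ⟨le_of_lt ht2, le_of_lt ht1⟩
    refine (h3.sub hU1).congr fun t ↦ ?_
    simp [hw₀]
  · rcases eq_or_ne t 1 with rfl | ht1
    · -- the almost sure limit and the limit in `L²` agree
      let s : ℕ → ℝ := fun n ↦ 1 - 1 / ((n : ℝ) + 1)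
      have hs : ∀ n, s n ∈ Ico (0 : ℝ) 1 := fun n ↦ ⟨sub_nonneg.2 (by
        rw [div_le_one (by positivity)]; linarith [n.cast_nonneg (α := ℝ)]),
        sub_lt_self _ (by positivity)⟩
      have hs1 : Tendsto s atTop (𝓝[<] 1) := by
        refine tendsto_nhdsWithin_iff.2 ⟨?_, Eventually.of_forall fun n ↦ (hs n).2⟩
        have : Tendsto s atTop (𝓝 (1 - 0)) :=
          tendsto_const_nhds.sub (tendsto_one_div_add_atTop_nhds_zero_nat (𝕜 := ℝ))
        rwa [sub_zero] at this
      have hL : Tendsto (fun n ↦ J (innovVec h' g' a b (s n))) atTop (𝓝 (J (v 1))) :=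
        (J.continuous.tendsto _).comp (hv2.comp hs1)
      obtain ⟨ns, hns, hae⟩ := (tendstoInMeasure_of_tendsto_Lp hL).exists_seq_tendsto_ae
      have hall : ∀ᵐ ω ∂P, ∀ n, w₀ (s n) ω = J (innovVec h' g' a b (s n)) ω :=
        ae_all_iff.2 fun n ↦ hw₀v _ (hs n)
      filter_upwards [hae, hall, hlim'] with ω h1 h2 h3
      refine tendsto_nhds_unique (h3.comp (hs1.comp hns.tendsto_atTop)) (h1.congr fun n ↦ ?_)
      exact (h2 _).symm
    · rw [hne t ht1, hv1 t ht1]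
      exact hw₀v t ⟨ht.1, lt_of_le_of_ne ht.2 ht1⟩
  · filter_upwards [hw₀c, hlim'] with ω h1 h2 t ht
    rcases eq_or_ne t 1 with rfl | ht1
    · rw [← Ico_insert_right zero_le_one, continuousWithinAt_insert_self]
      refine (h2.mono_left (nhdsWithin_mono _ fun x hx ↦ hx.2)).congr' ?_
      filter_upwards [self_mem_nhdsWithin] with x hx
      rw [hne x hx.2.ne]
    · have ht' : t < 1 := lt_of_le_of_ne ht.2 ht1
      have h3 : ContinuousWithinAt (fun t ↦ w₀ t ω) (Icc 0 1) t := by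
        refine (h1 t ⟨ht.1, ht'⟩).mono_of_mem_nhdsWithin ?_
        filter_upwards [self_mem_nhdsWithin, mem_nhdsWithin_of_mem_nhds (Iio_mem_nhds ht')]
          with x hx1 hx2 using ⟨hx1.1, hx2⟩
      refine h3.congr_of_eventuallyEq ?_ (by rw [hne t ht1])
      filter_upwards [mem_nhdsWithin_of_mem_nhds (Iio_mem_nhds ht')] with x hx
      rw [hne x (ne_of_lt hx)]

end MDE

theorem theorem1 {Ω : Type*} [MeasurableSpace Ω] (P : Measure Ω) [IsProbabilityMeasure P]
    (W : ℝ → Ω → ℝ) (hW : MDE.IsWienerProcess W P)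
    (h g : ℝ → ℝ) (hh : ContinuousOn h (Icc 0 1)) (hg : ContinuousOn g (Icc 0 1))
    (hg_norm : ∫ q in (0 : ℝ)..1, g q ^ 2 = 1)
    (hφ : ∀ r ∈ Ico (0 : ℝ) 1, 0 < MDE.phi2 h g r) :
    (∃ ξ : Ω → ℝ, MDE.HasStochIntegral P W g 0 1 ξ) ∧
    ∀ ξ : Ω → ℝ, MDE.HasStochIntegral P W g 0 1 ξ →
      (∃ Y : ℝ → Ω → ℝ, MDE.IsInnerIntegral P h g (MDE.limitProcess W ξ h) Y) ∧
      ∀ Y : ℝ → Ω → ℝ, MDE.IsInnerIntegral P h g (MDE.limitProcess W ξ h) Y →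
        ∃ w : ℝ → Ω → ℝ, MDE.IsTransform P (MDE.limitProcess W ξ h) Y w ∧
          MDE.IsWienerProcess w P := by
  obtain ⟨J, hJ⟩ := hW.exists_isWienerIntegral
  obtain ⟨h', hh'⟩ := MDE.exists_continuousMap_eqOn hh
  obtain ⟨g', hg'⟩ := MDE.exists_continuousMap_eqOn hg
  have hnorm : ∫ q in (0 : ℝ)..1, g' q ^ 2 = 1 := by
    refine (intervalIntegral.integral_congr fun q hq ↦ ?_).trans hg_norm
    rw [uIcc_of_le zero_le_one] at hq
    simp only [hg' q hq]
  have K := MDE.kernelSystem_phi (h := h') hnorm fun r hr ↦ by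
    rw [(MDE.phi_congr hh' hg' ⟨hr.1, hr.2.le⟩).2.1]
    exact hφ r hr
  refine ⟨⟨J (MDE.cut g' 1), (hJ.hasStochIntegral_iff hg' _).2 .rfl⟩, fun ξ hξ ↦ ?_⟩
  rw [hJ.hasStochIntegral_iff hg'] at hξ
  refine ⟨hJ.exists_isInnerIntegral hh' hg' hξ, fun Y hY ↦ ?_⟩
  exact hJ.exists_isTransform hW hh' K hξ hY.measurable fun r hr ↦
    (hJ.hasStochIntegral_kernel_iff hh' hg' hξ hr _).1 (hY.integral r hr)
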